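/- Consider the two-sorted first-order language with a sort $\iota$ of numbers and a sort $\kappa$ of classes of numbers; function symbols $0, S, \mathit{Pred}, +, \times$ on numbers; an arbitrary family $F$ of additional function symbols $F_i$ of rank $\langle \iota,\dots,\iota,\iota\rangle$ (of any arities); predicate symbols $=$, $N$, $\mathit{Null}$ on numbers and membership $\epsilon$ of rank $\langle\iota,\kappa\rangle$; and a function symbol $f_{x,y_1,\dots,y_n,A}$ with values in $\kappa$ for every comprehension instance, i.e. for every proposition $A$ of the language without these symbols whose free variables are among $x$ (of sort $\iota$) and $y_1,\dots,y_n$. In the predicative version, $A$ contains neither $\epsilon$ nor quantifiers over $\kappa$ and the $y_i$ have sort $\iota$; in the impredicative version, $A$ is arbitrary and the $y_i$ have sort $\iota$ or $\kappa$. The rewrite system $HA$ consists of $$x~\epsilon~f_{x,y_1,\dots,y_n,A}(y_1,\dots,y_n)\to A,\qquad y=z\to\forall X\,(y~\epsilon~X\Rightarrow z~\epsilon~X),$$ $$N(n)\to\forall X\,\bigl(0~\epsilon~X\Rightarrow\forall y\,(N(y)\Rightarrow y~\epsilon~X\Rightarrow S(y)~\epsilon~X)\Rightarrow n~\epsilon~X\bigr),$$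 $$\mathit{Null}(0)\to\top,\quad \mathit{Null}(S(x))\to\bot,\quad \mathit{Pred}(0)\to 0,\quad \mathit{Pred}(S(x))\to x,$$ $$0+y\to y,\quad S(x)+y\to S(x+y),\quad 0\times y\to 0,\quad S(x)\times y\to x\times y+y.$$ Let $\mathcal E$ be an arbitrary set of equational axioms $\forall x_1\dots\forall x_p\,(t=u)$ between terms $t,u$ of sort $\iota$, and let $\equiv_{HA\cup\mathcal E}$ be the congruence on terms and propositions defined by the rules of $HA$ and the equations of $\mathcal E$: the least equivalence relation containing all their substitution instances and compatible with function symbols, predicate symbols, connectives and quantifiers. Then, in either version (predicative or impredicative), intuitionistic natural deduction modulo $\equiv_{HA\cup\mathcal E}$ has the cut elimination property: every proof-term $\pi$ of every sequent $\Gamma\vdash A$ is strongly normalizing for the reduction that contracts cuts (an introduction rule followed by an elimination of the same connective or quantifier) anywhere in a proof-term, and $\pi$ reduces to a cut-free (normal) proof-term that is again a proof of $\Gamma\vdash A$. -/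

import Mathlib

universe u

namespace DeductionModulo

/-! ### Many-sorted first-order syntax -/

/-- A many-sorted first-order signature over the sorts `S`. `Func as s` is the type of function
symbols of rank `⟨as, s⟩` and `Pred as` the type of predicate symbols of rank `as`. -/
structure Signature (S : Type) where
  Func : List S → S → Type u
  Pred : List S → Type

/-- `Var Δ s`: the variables of sort `s` declared in the variable context `Δ`
(well-scoped de Bruijn indices). -/
inductive Var {S : Type} : List S → S → Type
  | zero {s : S} {Δ : List S} : Var (s :: Δ) s
  | succ {s r : S} {Δ : List S} (v : Var Δ s) : Var (r :: Δ) s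

/-- Terms of sort `s` whose variables are declared in `Δ`. The arguments of a symbol of rank
`⟨as, s⟩` are indexed by the positions of the list `as`. -/
inductive Term {S : Type} (L : Signature.{u} S) (Δ : List S) : S → Type u
  | var {s : S} (v : Var Δ s) : Term L Δ s
  | app {as : List S} {s : S} (f : L.Func as s) (args : ∀ r : S, Var as r → Term L Δ r) :
      Term L Δ s

/-- Simultaneous substitutions (and, equally, tuples of arguments): a term over `Δ'` of the right
sort for each variable declared in `Δ`. -/
abbrev Subst {S : Type} (L : Signature.{u} S) (Δ Δ' : List S) : Type u :=
  ∀ s : S, Var Δ s → Term L Δ' s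

/-- Propositions whose free variables are declared in `Δ`. -/
inductive Formula {S : Type} (L : Signature.{u} S) : List S → Type u
  | atom {Δ : List S} {as : List S} (P : L.Pred as) (args : Subst L as Δ) : Formula L Δ
  | top {Δ : List S} : Formula L Δ
  | bot {Δ : List S} : Formula L Δ
  | and {Δ : List S} (A B : Formula L Δ) : Formula L Δ
  | or {Δ : List S} (A B : Formula L Δ) : Formula L Δ
  | imp {Δ : List S} (A B : Formula L Δ) : Formula L Δ
  | all {Δ : List S} (s : S) (A : Formula L (s :: Δ)) : Formula L Δ
  | ex {Δ : List S} (s : S) (A : Formula L (s :: Δ)) : Formula L Δ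

section Substitution

variable {S : Type} {L : Signature.{u} S}

def Term.subst {Δ Δ' : List S} (σ : Subst L Δ Δ') : {s : S} → Term L Δ s → Term L Δ' s
  | s, .var v => σ s v
  | _, .app f args => .app f (fun r v => (args r v).subst σ)

def Subst.id (Δ : List S) : Subst L Δ Δ := fun _ v => .var v

def Subst.nil {Δ : List S} : Subst L [] Δ := fun _ v => nomatch v

def Subst.cons {s : S} {Δ Δ' : List S} (t : Term L Δ' s) (σ : Subst L Δ Δ') :
    Subst L (s :: Δ) Δ'
  | _, .zero => t
  | r, .succ v => σ r v

/-- Weakening by one fresh variable of sort `s`. -/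
def Subst.wk {Δ : List S} (s : S) : Subst L Δ (s :: Δ) := fun _ v => .var (.succ v)

/-- The substitution `(t/x)` for the last declared variable `x`. -/
def Subst.inst {s : S} {Δ : List S} (t : Term L Δ s) : Subst L (s :: Δ) Δ :=
  Subst.cons t (Subst.id Δ)

/-- Extension of a substitution under a binder (it leaves the bound variable fixed). -/
def Subst.lift {Δ Δ' : List S} (s : S) (σ : Subst L Δ Δ') : Subst L (s :: Δ) (s :: Δ') :=
  Subst.cons (.var .zero) (fun r v => (σ r v).subst (Subst.wk s))

def Formula.subst : {Δ : List S} → Formula L Δ → {Δ' : List S} → Subst L Δ Δ' → Formula L Δ'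
  | _, .atom P args, _, σ => .atom P (fun r v => (args r v).subst σ)
  | _, .top, _, _ => .top
  | _, .bot, _, _ => .bot
  | _, .and A B, _, σ => .and (A.subst σ) (B.subst σ)
  | _, .or A B, _, σ => .or (A.subst σ) (B.subst σ)
  | _, .imp A B, _, σ => .imp (A.subst σ) (B.subst σ)
  | _, .all s A, _, σ => .all s (A.subst (σ.lift s))
  | _, .ex s A, _, σ => .ex s (A.subst (σ.lift s))

end Substitution

/-! ### Inclusions of languages -/

/-- A map of symbols between two signatures, preserving ranks. -/
structure Signature.Hom {S : Type} (L L' : Signature.{u} S) where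
  onFunc : ∀ {as : List S} {s : S}, L.Func as s → L'.Func as s
  onPred : ∀ {as : List S}, L.Pred as → L'.Pred as

def Term.map {S : Type} {L L' : Signature.{u} S} (h : L.Hom L') {Δ : List S} :
    {s : S} → Term L Δ s → Term L' Δ s
  | _, .var v => .var v
  | _, .app f args => .app (h.onFunc f) (fun r v => (args r v).map h)

def Formula.map {S : Type} {L L' : Signature.{u} S} (h : L.Hom L') :
    {Δ : List S} → Formula L Δ → Formula L' Δ
  | _, .atom P args => .atom (h.onPred P) (fun r v => (args r v).map h)
  | _, .top => .top
  | _, .bot => .bot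
  | _, .and A B => .and (A.map h) (B.map h)
  | _, .or A B => .or (A.map h) (B.map h)
  | _, .imp A B => .imp (A.map h) (B.map h)
  | _, .all s A => .all s (A.map h)
  | _, .ex s A => .ex s (A.map h)

/-! ### Congruences defined by rewrite rules and equational axioms -/

/-- A set of rewrite rules and equational axioms: pairs of terms of the same sort, and pairs of
propositions, each over the context `Δ` of its free variables. -/
structure RewriteSystem {S : Type} (L : Signature.{u} S) where
  termRule : ∀ {Δ : List S} {s : S}, Term L Δ s → Term L Δ s → Prop
  propRule : ∀ {Δ : List S}, Formula L Δ → Formula L Δ → Prop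

section Congruence

variable {S : Type} {L : Signature.{u} S}

/-- The congruence defined by `R`, on terms. -/
inductive TermCongr (R : RewriteSystem L) {Δ : List S} :
    {s : S} → Term L Δ s → Term L Δ s → Prop
  | rule {Δ₀ : List S} {s : S} {l r : Term L Δ₀ s} (h : R.termRule l r) (σ : Subst L Δ₀ Δ) :
      TermCongr R (l.subst σ) (r.subst σ)
  | refl {s : S} (t : Term L Δ s) : TermCongr R t t
  | symm {s : S} {t t' : Term L Δ s} : TermCongr R t t' → TermCongr R t' t
  | trans {s : S} {t t' t'' : Term L Δ s} :
      TermCongr R t t' → TermCongr R t' t'' → TermCongr R t t''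
  | app {as : List S} {s : S} (f : L.Func as s) {a b : Subst L as Δ}
      (h : ∀ (r : S) (v : Var as r), TermCongr R (a r v) (b r v)) :
      TermCongr R (.app f a) (.app f b)

/-- The congruence defined by `R`, on propositions. -/
inductive Congr (R : RewriteSystem L) : {Δ : List S} → Formula L Δ → Formula L Δ → Prop
  | rule {Δ₀ Δ : List S} {l r : Formula L Δ₀} (h : R.propRule l r) (σ : Subst L Δ₀ Δ) :
      Congr R (l.subst σ) (r.subst σ)
  | refl {Δ : List S} (A : Formula L Δ) : Congr R A A
  | symm {Δ : List S} {A B : Formula L Δ} : Congr R A B → Congr R B A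
  | trans {Δ : List S} {A B C : Formula L Δ} : Congr R A B → Congr R B C → Congr R A C
  | atom {Δ : List S} {as : List S} (P : L.Pred as) {a b : Subst L as Δ}
      (h : ∀ (r : S) (v : Var as r), TermCongr R (a r v) (b r v)) :
      Congr R (.atom P a) (.atom P b)
  | and {Δ : List S} {A A' B B' : Formula L Δ} :
      Congr R A A' → Congr R B B' → Congr R (.and A B) (.and A' B')
  | or {Δ : List S} {A A' B B' : Formula L Δ} :
      Congr R A A' → Congr R B B' → Congr R (.or A B) (.or A' B')
  | imp {Δ : List S} {A A' B B' : Formula L Δ} :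
      Congr R A A' → Congr R B B' → Congr R (.imp A B) (.imp A' B')
  | all {Δ : List S} (s : S) {A A' : Formula L (s :: Δ)} :
      Congr R A A' → Congr R (.all s A) (.all s A')
  | ex {Δ : List S} (s : S) {A A' : Formula L (s :: Δ)} :
      Congr R A A' → Congr R (.ex s A) (.ex s A')

end Congruence

/-! ### Proof-terms and their reduction -/

/-- Proof-terms over the variable context `Δ`. Proof variables are de Bruijn indices; the comments
give the usual notation. -/
inductive Proof {S : Type} (L : Signature.{u} S) : List S → Type u
  /-- `α` -/
  | hyp {Δ : List S} (n : ℕ) : Proof L Δ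
  /-- `I` -/
  | triv {Δ : List S} : Proof L Δ
  /-- `δ_⊥(π)` -/
  | botE {Δ : List S} (p : Proof L Δ) : Proof L Δ
  /-- `⟨π₁, π₂⟩` -/
  | pair {Δ : List S} (p q : Proof L Δ) : Proof L Δ
  | fst {Δ : List S} (p : Proof L Δ) : Proof L Δ
  | snd {Δ : List S} (p : Proof L Δ) : Proof L Δ
  /-- `i(π)` -/
  | inl {Δ : List S} (p : Proof L Δ) : Proof L Δ
  /-- `j(π)` -/
  | inr {Δ : List S} (p : Proof L Δ) : Proof L Δ
  /-- `δ(π₁, α π₂, β π₃)`; binds one proof variable in `q` and one in `r` -/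
  | case {Δ : List S} (p q r : Proof L Δ) : Proof L Δ
  /-- `λ α π`; binds one proof variable -/
  | lam {Δ : List S} (p : Proof L Δ) : Proof L Δ
  /-- `(π₁ π₂)` -/
  | app {Δ : List S} (p q : Proof L Δ) : Proof L Δ
  /-- `λ x π`, with `x` of sort `s` -/
  | tlam {Δ : List S} (s : S) (p : Proof L (s :: Δ)) : Proof L Δ
  /-- `(π t)` -/
  | tapp {Δ : List S} {s : S} (p : Proof L Δ) (t : Term L Δ s) : Proof L Δ
  /-- `⟨t, π⟩` -/
  | pack {Δ : List S} {s : S} (t : Term L Δ s) (p : Proof L Δ) : Proof L Δ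
  /-- `δ_∃(π₁, x α π₂)`; binds `x` of sort `s` and one proof variable in `q` -/
  | unpack {Δ : List S} {s : S} (p : Proof L Δ) (q : Proof L (s :: Δ)) : Proof L Δ

section Proofs

variable {S : Type} {L : Signature.{u} S}

/-- Substitution of terms for the term variables of a proof-term. -/
def Proof.tsubst : {Δ : List S} → Proof L Δ → {Δ' : List S} → Subst L Δ Δ' → Proof L Δ'
  | _, .hyp n, _, _ => .hyp n
  | _, .triv, _, _ => .triv
  | _, .botE p, _, σ => .botE (p.tsubst σ)
  | _, .pair p q, _, σ => .pair (p.tsubst σ) (q.tsubst σ)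
  | _, .fst p, _, σ => .fst (p.tsubst σ)
  | _, .snd p, _, σ => .snd (p.tsubst σ)
  | _, .inl p, _, σ => .inl (p.tsubst σ)
  | _, .inr p, _, σ => .inr (p.tsubst σ)
  | _, .case p q r, _, σ => .case (p.tsubst σ) (q.tsubst σ) (r.tsubst σ)
  | _, .lam p, _, σ => .lam (p.tsubst σ)
  | _, .app p q, _, σ => .app (p.tsubst σ) (q.tsubst σ)
  | _, .tlam s p, _, σ => .tlam s (p.tsubst (σ.lift s))
  | _, .tapp p t, _, σ => .tapp (p.tsubst σ) (t.subst σ)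
  | _, .pack t p, _, σ => .pack (t.subst σ) (p.tsubst σ)
  | _, .unpack (s := s) p q, _, σ => .unpack (p.tsubst σ) (q.tsubst (σ.lift s))

def liftRen (ρ : ℕ → ℕ) : ℕ → ℕ
  | 0 => 0
  | n + 1 => ρ n + 1

/-- Renaming of proof variables. -/
def Proof.ren : {Δ : List S} → (ℕ → ℕ) → Proof L Δ → Proof L Δ
  | _, ρ, .hyp n => .hyp (ρ n)
  | _, _, .triv => .triv
  | _, ρ, .botE p => .botE (p.ren ρ)
  | _, ρ, .pair p q => .pair (p.ren ρ) (q.ren ρ)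
  | _, ρ, .fst p => .fst (p.ren ρ)
  | _, ρ, .snd p => .snd (p.ren ρ)
  | _, ρ, .inl p => .inl (p.ren ρ)
  | _, ρ, .inr p => .inr (p.ren ρ)
  | _, ρ, .case p q r => .case (p.ren ρ) (q.ren (liftRen ρ)) (r.ren (liftRen ρ))
  | _, ρ, .lam p => .lam (p.ren (liftRen ρ))
  | _, ρ, .app p q => .app (p.ren ρ) (q.ren ρ)
  | _, ρ, .tlam s p => .tlam s (p.ren ρ)
  | _, ρ, .tapp p t => .tapp (p.ren ρ) t
  | _, ρ, .pack t p => .pack t (p.ren ρ)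
  | _, ρ, .unpack p q => .unpack (p.ren ρ) (q.ren (liftRen ρ))

/-- Extension of a substitution of proof variables under a binder of a proof variable. -/
def liftHyp {Δ : List S} (τ : ℕ → Proof L Δ) : ℕ → Proof L Δ
  | 0 => .hyp 0
  | n + 1 => (τ n).ren Nat.succ

/-- Extension of a substitution of proof variables under a binder of a term variable. -/
def wkHyp {Δ : List S} (s : S) (τ : ℕ → Proof L Δ) : ℕ → Proof L (s :: Δ) :=
  fun n => (τ n).tsubst (Subst.wk s)

/-- Substitution of proof-terms for the proof variables of a proof-term. -/
def Proof.hsubst : {Δ : List S} → (ℕ → Proof L Δ) → Proof L Δ → Proof L Δ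
  | _, τ, .hyp n => τ n
  | _, _, .triv => .triv
  | _, τ, .botE p => .botE (p.hsubst τ)
  | _, τ, .pair p q => .pair (p.hsubst τ) (q.hsubst τ)
  | _, τ, .fst p => .fst (p.hsubst τ)
  | _, τ, .snd p => .snd (p.hsubst τ)
  | _, τ, .inl p => .inl (p.hsubst τ)
  | _, τ, .inr p => .inr (p.hsubst τ)
  | _, τ, .case p q r =>
      .case (p.hsubst τ) (q.hsubst (liftHyp τ)) (r.hsubst (liftHyp τ))
  | _, τ, .lam p => .lam (p.hsubst (liftHyp τ))
  | _, τ, .app p q => .app (p.hsubst τ) (q.hsubst τ)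
  | _, τ, .tlam s p => .tlam s (p.hsubst (wkHyp s τ))
  | _, τ, .tapp p t => .tapp (p.hsubst τ) t
  | _, τ, .pack t p => .pack t (p.hsubst τ)
  | _, τ, .unpack (s := s) p q => .unpack (p.hsubst τ) (q.hsubst (liftHyp (wkHyp s τ)))

/-- `p.inst q` is `(q/α)p` for the last bound proof variable `α` of `p`. -/
def Proof.inst {Δ : List S} (p q : Proof L Δ) : Proof L Δ :=
  p.hsubst (fun n => Nat.casesOn n q (fun m => .hyp m))

/-- One step of reduction: contraction of one cut, anywhere in the proof-term. -/
inductive Step : {Δ : List S} → Proof L Δ → Proof L Δ → Prop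
  | fst_pair {Δ : List S} (p q : Proof L Δ) : Step (.fst (.pair p q)) p
  | snd_pair {Δ : List S} (p q : Proof L Δ) : Step (.snd (.pair p q)) q
  | case_inl {Δ : List S} (p q r : Proof L Δ) : Step (.case (.inl p) q r) (q.inst p)
  | case_inr {Δ : List S} (p q r : Proof L Δ) : Step (.case (.inr p) q r) (r.inst p)
  | app_lam {Δ : List S} (p q : Proof L Δ) : Step (.app (.lam p) q) (p.inst q)
  | tapp_tlam {Δ : List S} {s : S} (p : Proof L (s :: Δ)) (t : Term L Δ s) :
      Step (.tapp (.tlam s p) t) (p.tsubst (Subst.inst t))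
  | unpack_pack {Δ : List S} {s : S} (t : Term L Δ s) (p : Proof L Δ) (q : Proof L (s :: Δ)) :
      Step (.unpack (.pack t p) q) ((q.tsubst (Subst.inst t)).inst p)
  | botE {Δ : List S} {p p' : Proof L Δ} : Step p p' → Step (.botE p) (.botE p')
  | pair_left {Δ : List S} {p p' : Proof L Δ} (q : Proof L Δ) :
      Step p p' → Step (.pair p q) (.pair p' q)
  | pair_right {Δ : List S} (p : Proof L Δ) {q q' : Proof L Δ} :
      Step q q' → Step (.pair p q) (.pair p q')
  | fst {Δ : List S} {p p' : Proof L Δ} : Step p p' → Step (.fst p) (.fst p')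
  | snd {Δ : List S} {p p' : Proof L Δ} : Step p p' → Step (.snd p) (.snd p')
  | inl {Δ : List S} {p p' : Proof L Δ} : Step p p' → Step (.inl p) (.inl p')
  | inr {Δ : List S} {p p' : Proof L Δ} : Step p p' → Step (.inr p) (.inr p')
  | case_major {Δ : List S} {p p' : Proof L Δ} (q r : Proof L Δ) :
      Step p p' → Step (.case p q r) (.case p' q r)
  | case_left {Δ : List S} (p : Proof L Δ) {q q' : Proof L Δ} (r : Proof L Δ) :
      Step q q' → Step (.case p q r) (.case p q' r)
  | case_right {Δ : List S} (p q : Proof L Δ) {r r' : Proof L Δ} :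
      Step r r' → Step (.case p q r) (.case p q r')
  | lam {Δ : List S} {p p' : Proof L Δ} : Step p p' → Step (.lam p) (.lam p')
  | app_left {Δ : List S} {p p' : Proof L Δ} (q : Proof L Δ) :
      Step p p' → Step (.app p q) (.app p' q)
  | app_right {Δ : List S} (p : Proof L Δ) {q q' : Proof L Δ} :
      Step q q' → Step (.app p q) (.app p q')
  | tlam {Δ : List S} (s : S) {p p' : Proof L (s :: Δ)} :
      Step p p' → Step (.tlam s p) (.tlam s p')
  | tapp {Δ : List S} {s : S} {p p' : Proof L Δ} (t : Term L Δ s) :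
      Step p p' → Step (.tapp p t) (.tapp p' t)
  | pack {Δ : List S} {s : S} (t : Term L Δ s) {p p' : Proof L Δ} :
      Step p p' → Step (.pack t p) (.pack t p')
  | unpack_left {Δ : List S} {s : S} {p p' : Proof L Δ} (q : Proof L (s :: Δ)) :
      Step p p' → Step (.unpack p q) (.unpack p' q)
  | unpack_right {Δ : List S} {s : S} (p : Proof L Δ) {q q' : Proof L (s :: Δ)} :
      Step q q' → Step (.unpack p q) (.unpack p q')

/-- A proof-term is normal (cut-free) if it contains no cut. -/
def Normal {Δ : List S} (p : Proof L Δ) : Prop := ∀ p' : Proof L Δ, ¬ Step p p'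

/-- A proof-term is strongly normalizing if it has no infinite reduction sequence, stated as
well-foundedness of its reduction tree. -/
def StronglyNormalizing {Δ : List S} (p : Proof L Δ) : Prop :=
  Acc (fun q q' : Proof L Δ => Step q' q) p

/-! ### Natural deduction modulo -/

/-- `Derives R Γ π A`: the proof-term `π` is a proof of the sequent `Γ ⊢ A` in intuitionistic
natural deduction modulo the congruence defined by `R`. The freshness conditions on bound variables
are expressed by weakening. -/
inductive Derives (R : RewriteSystem L) :
    {Δ : List S} → List (Formula L Δ) → Proof L Δ → Formula L Δ → Prop
  | ax {Δ : List S} {Γ : List (Formula L Δ)} {n : ℕ} {A B : Formula L Δ} :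
      Γ[n]? = some A → Congr R A B → Derives R Γ (.hyp n) B
  | topI {Δ : List S} {Γ : List (Formula L Δ)} {A : Formula L Δ} :
      Congr R A .top → Derives R Γ .triv A
  | botE {Δ : List S} {Γ : List (Formula L Δ)} {p : Proof L Δ} {A B : Formula L Δ} :
      Derives R Γ p B → Congr R B .bot → Derives R Γ (.botE p) A
  | andI {Δ : List S} {Γ : List (Formula L Δ)} {p q : Proof L Δ} {A B C : Formula L Δ} :
      Derives R Γ p A → Derives R Γ q B → Congr R C (.and A B) → Derives R Γ (.pair p q) C
  | andE₁ {Δ : List S} {Γ : List (Formula L Δ)} {p : Proof L Δ} {A B C : Formula L Δ} :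
      Derives R Γ p C → Congr R C (.and A B) → Derives R Γ (.fst p) A
  | andE₂ {Δ : List S} {Γ : List (Formula L Δ)} {p : Proof L Δ} {A B C : Formula L Δ} :
      Derives R Γ p C → Congr R C (.and A B) → Derives R Γ (.snd p) B
  | orI₁ {Δ : List S} {Γ : List (Formula L Δ)} {p : Proof L Δ} {A B C : Formula L Δ} :
      Derives R Γ p A → Congr R C (.or A B) → Derives R Γ (.inl p) C
  | orI₂ {Δ : List S} {Γ : List (Formula L Δ)} {p : Proof L Δ} {A B C : Formula L Δ} :
      Derives R Γ p B → Congr R C (.or A B) → Derives R Γ (.inr p) C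
  | orE {Δ : List S} {Γ : List (Formula L Δ)} {p q r : Proof L Δ} {A B C D : Formula L Δ} :
      Derives R Γ p D → Derives R (A :: Γ) q C → Derives R (B :: Γ) r C →
      Congr R D (.or A B) → Derives R Γ (.case p q r) C
  | impI {Δ : List S} {Γ : List (Formula L Δ)} {p : Proof L Δ} {A B C : Formula L Δ} :
      Derives R (A :: Γ) p B → Congr R C (.imp A B) → Derives R Γ (.lam p) C
  | impE {Δ : List S} {Γ : List (Formula L Δ)} {p q : Proof L Δ} {A B C : Formula L Δ} :
      Derives R Γ p C → Derives R Γ q A → Congr R C (.imp A B) → Derives R Γ (.app p q) B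
  | allI {Δ : List S} {s : S} {Γ : List (Formula L Δ)} {p : Proof L (s :: Δ)}
      {A : Formula L (s :: Δ)} {B : Formula L Δ} :
      Derives R (Γ.map (fun C => C.subst (Subst.wk s))) p A → Congr R B (.all s A) →
      Derives R Γ (.tlam s p) B
  | allE {Δ : List S} {s : S} {Γ : List (Formula L Δ)} {p : Proof L Δ} {t : Term L Δ s}
      {A : Formula L (s :: Δ)} {B C : Formula L Δ} :
      Derives R Γ p B → Congr R B (.all s A) → Congr R C (A.subst (Subst.inst t)) →
      Derives R Γ (.tapp p t) C
  | exI {Δ : List S} {s : S} {Γ : List (Formula L Δ)} {p : Proof L Δ} {t : Term L Δ s}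
      {A : Formula L (s :: Δ)} {B C : Formula L Δ} :
      Derives R Γ p C → Congr R B (.ex s A) → Congr R C (A.subst (Subst.inst t)) →
      Derives R Γ (.pack t p) B
  | exE {Δ : List S} {s : S} {Γ : List (Formula L Δ)} {p : Proof L Δ} {q : Proof L (s :: Δ)}
      {A : Formula L (s :: Δ)} {B C : Formula L Δ} :
      Derives R Γ p C →
      Derives R (A :: Γ.map (fun C => C.subst (Subst.wk s))) q (B.subst (Subst.wk s)) →
      Congr R C (.ex s A) → Derives R Γ (.unpack p q) B

/-- The cut elimination property of deduction modulo the congruence defined by `R`: every proof is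
strongly normalizing, and it reduces to a cut-free proof of the same sequent. -/
def CutElimination (R : RewriteSystem L) : Prop :=
  ∀ (Δ : List S) (Γ : List (Formula L Δ)) (p : Proof L Δ) (A : Formula L Δ),
    Derives R Γ p A →
      StronglyNormalizing p ∧
      ∃ p' : Proof L Δ, Relation.ReflTransGen Step p p' ∧ Normal p' ∧ Derives R Γ p' A

end Proofs

/-! ### Arithmetic -/

namespace Arith

/-- The two sorts: `nat` for numbers (`ι`) and `cls` for unary classes (`κ`). -/
inductive Srt : Type
  | nat
  | cls

open Srt

/-- Function symbols: those of arithmetic, the additional symbols `F n` of arity `n` on numbers,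
and symbols `K ys` for classes with parameters of sorts `ys`. -/
inductive Func (F : ℕ → Type u) (K : List Srt → Type u) : List Srt → Srt → Type u
  | zero : Func F K [] nat
  | succ : Func F K [nat] nat
  | pred : Func F K [nat] nat
  | add : Func F K [nat, nat] nat
  | mul : Func F K [nat, nat] nat
  | fn {n : ℕ} (f : F n) : Func F K (List.replicate n nat) nat
  | comp {ys : List Srt} (k : K ys) : Func F K ys cls

/-- Predicate symbols: `=`, `N`, `Null` and membership `ε`. -/
inductive Pred : List Srt → Type
  | eq : Pred [nat, nat]
  | isNat : Pred [nat]
  | null : Pred [nat]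
  | mem : Pred [nat, cls]

def sig (F : ℕ → Type u) (K : List Srt → Type u) : Signature.{u} Srt where
  Func := Func F K
  Pred := Pred

/-- The language without comprehension (Skolem) symbols. -/
abbrev baseSig (F : ℕ → Type u) : Signature.{u} Srt := sig F (fun _ => PEmpty)

def Pred.IsMem : {as : List Srt} → Pred as → Prop
  | _, .mem => True
  | _, _ => False

/-- A proposition is arithmetical if it contains neither `ε` nor quantifiers over classes. -/
def IsArithmetical {F : ℕ → Type u} {K : List Srt → Type u} :
    {Δ : List Srt} → Formula (sig F K) Δ → Prop
  | _, .atom P _ => ¬ Pred.IsMem P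
  | _, .top => True
  | _, .bot => True
  | _, .and A B => IsArithmetical A ∧ IsArithmetical B
  | _, .or A B => IsArithmetical A ∧ IsArithmetical B
  | _, .imp A B => IsArithmetical A ∧ IsArithmetical B
  | _, .all s A => s = nat ∧ IsArithmetical A
  | _, .ex s A => s = nat ∧ IsArithmetical A

/-- The two versions of the comprehension scheme. -/
inductive Scheme : Type
  | predicative
  | impredicative

/-- Which propositions `A`, with free variables among `x, y₁, …, yₙ` (where `x` is a number and the
`yᵢ` have sorts `ys`), define a class by comprehension. -/
def Scheme.Admits {F : ℕ → Type u} (c : Scheme) {ys : List Srt}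
    (A : Formula (baseSig F) (nat :: ys)) : Prop :=
  match c with
  | .predicative =>
      (∀ s ∈ ys, s = nat) ∧ IsArithmetical A
  | .impredicative => True

/-- The symbols `f_{x, y₁, …, yₙ, A}`. -/
def Comp (F : ℕ → Type u) (c : Scheme) (ys : List Srt) : Type u :=
  {A : Formula (baseSig F) (nat :: ys) // c.Admits A}

/-- The language of arithmetic with classes, extended by the function symbols `F`. -/
abbrev lang (F : ℕ → Type u) (c : Scheme) : Signature.{u} Srt := sig F (Comp F c)

/-- The inclusion of the language without comprehension symbols. -/
def incl (F : ℕ → Type u) (K : List Srt → Type u) :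
    Signature.Hom (baseSig F) (sig F K) where
  onFunc := fun f =>
    match f with
    | .zero => Func.zero
    | .succ => Func.succ
    | .pred => Func.pred
    | .add => Func.add
    | .mul => Func.mul
    | .fn f => Func.fn f
    | .comp k => nomatch k
  onPred := fun P => P

section Notions

variable {F : ℕ → Type u} {K : List Srt → Type u} {Δ : List Srt}

def zero : Term (sig F K) Δ nat := .app Func.zero Subst.nil

def succ (t : Term (sig F K) Δ nat) : Term (sig F K) Δ nat :=
  .app Func.succ (Subst.cons t Subst.nil)

def pred (t : Term (sig F K) Δ nat) : Term (sig F K) Δ nat :=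
  .app Func.pred (Subst.cons t Subst.nil)

def add (t u : Term (sig F K) Δ nat) : Term (sig F K) Δ nat :=
  .app Func.add (Subst.cons t (Subst.cons u Subst.nil))

def mul (t u : Term (sig F K) Δ nat) : Term (sig F K) Δ nat :=
  .app Func.mul (Subst.cons t (Subst.cons u Subst.nil))

def eq (t u : Term (sig F K) Δ nat) : Formula (sig F K) Δ :=
  .atom (L := sig F K) Pred.eq (Subst.cons t (Subst.cons u Subst.nil))

def isNat (t : Term (sig F K) Δ nat) : Formula (sig F K) Δ :=
  .atom (L := sig F K) Pred.isNat (Subst.cons t Subst.nil)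

def null (t : Term (sig F K) Δ nat) : Formula (sig F K) Δ :=
  .atom (L := sig F K) Pred.null (Subst.cons t Subst.nil)

/-- `t ε X` -/
def mem (t : Term (sig F K) Δ nat) (X : Term (sig F K) Δ cls) : Formula (sig F K) Δ :=
  .atom (L := sig F K) Pred.mem (Subst.cons t (Subst.cons X Subst.nil))

/-- The most recently declared variable. -/
def v0 {s : Srt} : Term (sig F K) (s :: Δ) s := .var .zero

/-- The variable declared before it. -/
def v1 {s r : Srt} : Term (sig F K) (r :: s :: Δ) s := .var (.succ .zero)

/-- The variable declared before that. -/
def v2 {s r q : Srt} : Term (sig F K) (q :: r :: s :: Δ) s := .var (.succ (.succ .zero))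

end Notions

/-- An equational axiom `∀ x₁ … ∀ xₙ (lhs = rhs)` between terms of the sort of numbers, where
`vars` declares the variables `x₁, …, xₙ`. -/
structure Equation (L : Signature.{u} Srt) where
  vars : List Srt
  lhs : Term L vars nat
  rhs : Term L vars nat

section Rules

variable {F : ℕ → Type u} {c : Scheme}

/-- The rules of arithmetic rewriting terms, together with the equational axioms `E`. -/
inductive TermRule (E : Set (Equation (lang F c))) :
    {Δ : List Srt} → {s : Srt} → Term (lang F c) Δ s → Term (lang F c) Δ s → Prop
  | pred_zero : TermRule E (Δ := []) (pred zero) zero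
  | pred_succ : TermRule E (Δ := [nat]) (pred (succ v0)) v0
  | zero_add : TermRule E (Δ := [nat]) (add zero v0) v0
  | succ_add : TermRule E (Δ := [nat, nat]) (add (succ v0) v1) (succ (add v0 v1))
  | zero_mul : TermRule E (Δ := [nat]) (mul zero v0) zero
  | succ_mul : TermRule E (Δ := [nat, nat]) (mul (succ v0) v1) (add (mul v0 v1) v1)
  | ax (e : Equation (lang F c)) (he : e ∈ E) : TermRule E e.lhs e.rhs

/-- The rules of arithmetic rewriting atomic propositions. -/
inductive PropRule : {Δ : List Srt} → Formula (lang F c) Δ → Formula (lang F c) Δ → Prop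
  /-- `x ε f_{x, y₁, …, yₙ, A}(y₁, …, yₙ) ⟶ A` -/
  | comp {ys : List Srt} (A : Comp F c ys) :
      PropRule (Δ := nat :: ys)
        (mem v0 (.app (Func.comp A) (Subst.wk nat)))
        (A.1.map (incl F (Comp F c)))
  /-- `y = z ⟶ ∀ X (y ε X ⇒ z ε X)` -/
  | eq :
      PropRule (Δ := [nat, nat])
        (eq v0 v1)
        (.all cls (.imp (mem v1 v0) (mem v2 v0)))
  /-- `N(n) ⟶ ∀ X (0 ε X ⇒ ∀ y (N(y) ⇒ y ε X ⇒ S(y) ε X) ⇒ n ε X)` -/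
  | isNat :
      PropRule (Δ := [nat])
        (isNat v0)
        (.all cls (.imp (mem zero v0)
          (.imp (.all nat (.imp (isNat v0) (.imp (mem v0 v1) (mem (succ v0) v1))))
            (mem v1 v0))))
  | null_zero : PropRule (Δ := []) (null zero) .top
  | null_succ : PropRule (Δ := [nat]) (null (succ v0)) .bot

/-- The rewrite system `HA ∪ E`. -/
def HA (E : Set (Equation (lang F c))) : RewriteSystem (lang F c) where
  termRule := TermRule E
  propRule := PropRule

end Rules

end Arith

end DeductionModulo

/-! Cut elimination splits into two independent facts: subject reduction, and strong normalization
of typable proof-terms. Given both, well-founded induction along reduction reaches a normal proof of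
the same sequent (`cutElimination_of_stronglyNormalizing`).

Subject reduction (`Derives.step`) only needs the congruence to be injective on connectives and
quantifiers. Confluence is unavailable because the equations are arbitrary; they may even identify
`0` with `S(0)`, hence ⊤ with ⊥ through `Null`. What survives is a rigidity of class terms: every
term rule and every equation has sort `nat`, so congruent class terms have the same head symbol and
congruent arguments (`TermCongr.cls_inversion`). Unfolding `=`, `N` and `ε` at the root is therefore
a deterministic process that congruence respects, and congruent propositions unfold to compound
propositions with the same head and congruent immediate subformulas (`Congr.headReduces`).

Strong normalization comes from a model whose truth values are reducibility candidates. If every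
rule preserves interpretations, each derivable proof lies in the candidate of its conclusion
(`Derives.erase_mem`) and so is strongly normalizing. The model of arithmetic
(`fullModel_validates`) has a single number, which makes every equation between numbers true; a
class is an arbitrary candidate, so quantification over classes, even impredicative, is an
intersection or union over all candidates; ⊤ and ⊥ denote the same candidate, so `Null` can be
constant; `N` occurs in its own unfolding, but positively, so it is interpreted by a least fixed
point.

Because the interpretation never looks at terms inside proofs, normalization is carried out on
proof-terms with those terms erased. The erasure keeps a redex for each quantifier cut, so it loses
no reduction step. -/

namespace DeductionModulo

/-! ### Algebra of term substitutions -/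

section Substitutions

variable {S : Type} {L : Signature.{u} S}

/-- Composition of substitutions. -/
def Subst.comp {Δ Δ' Δ'' : List S} (σ : Subst L Δ Δ') (τ : Subst L Δ' Δ'') : Subst L Δ Δ'' :=
  fun s v => (σ s v).subst τ

theorem Term.subst_subst {Δ Δ' Δ'' : List S} (σ : Subst L Δ Δ') (τ : Subst L Δ' Δ'') {s : S}
    (t : Term L Δ s) : (t.subst σ).subst τ = t.subst (σ.comp τ) := by
  induction t with
  | var v => rfl
  | app f args ih => simp only [Term.subst, ih]

theorem Term.subst_id {Δ : List S} {s : S} (t : Term L Δ s) : t.subst (Subst.id Δ) = t := by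
  induction t with
  | var v => rfl
  | app f args ih => simp only [Term.subst, ih]

theorem Subst.ext_cons {s : S} {Δ Δ' : List S} {σ τ : Subst L (s :: Δ) Δ'}
    (h₀ : σ s .zero = τ s .zero) (h₁ : ∀ r (v : Var Δ r), σ r (.succ v) = τ r (.succ v)) :
    σ = τ := by
  funext r v
  cases v with
  | zero => exact h₀
  | succ v => exact h₁ r v

theorem Subst.lift_id (s : S) (Δ : List S) :
    (Subst.id Δ : Subst L Δ Δ).lift s = Subst.id (s :: Δ) :=
  Subst.ext_cons rfl fun _ _ => rfl

theorem Subst.wk_comp_lift {Δ Δ' : List S} (s : S) (σ : Subst L Δ Δ') :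
    (Subst.wk s).comp (σ.lift s) = σ.comp (Subst.wk s) := rfl

theorem Subst.lift_comp {Δ Δ' Δ'' : List S} (s : S) (σ : Subst L Δ Δ') (τ : Subst L Δ' Δ'') :
    (σ.lift s).comp (τ.lift s) = (σ.comp τ).lift s := by
  refine Subst.ext_cons rfl fun r v => ?_
  change ((σ r v).subst (Subst.wk s)).subst (τ.lift s) = ((σ r v).subst τ).subst (Subst.wk s)
  rw [Term.subst_subst, Term.subst_subst, Subst.wk_comp_lift]

theorem Subst.lift_comp_inst {Δ Δ' : List S} {s : S} (σ : Subst L Δ Δ') (t : Term L Δ' s) :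
    (σ.lift s).comp (Subst.inst t) = Subst.cons t σ := by
  refine Subst.ext_cons rfl fun r v => ?_
  change ((σ r v).subst (Subst.wk s)).subst (Subst.inst t) = σ r v
  rw [Term.subst_subst]
  exact Term.subst_id _

theorem Subst.inst_comp {Δ Δ' : List S} {s : S} (t : Term L Δ s) (σ : Subst L Δ Δ') :
    (Subst.inst t).comp σ = Subst.cons (t.subst σ) σ :=
  Subst.ext_cons rfl fun _ _ => rfl

theorem Formula.subst_subst {Δ Δ' Δ'' : List S} (A : Formula L Δ) (σ : Subst L Δ Δ')
    (τ : Subst L Δ' Δ'') : (A.subst σ).subst τ = A.subst (σ.comp τ) := by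
  induction A generalizing Δ' Δ'' with
  | atom P args => simp only [Formula.subst, Term.subst_subst]
  | top => rfl
  | bot => rfl
  | and A B ihA ihB => simp only [Formula.subst, ihA, ihB]
  | or A B ihA ihB => simp only [Formula.subst, ihA, ihB]
  | imp A B ihA ihB => simp only [Formula.subst, ihA, ihB]
  | all s A ih => simp only [Formula.subst, ih, Subst.lift_comp]
  | ex s A ih => simp only [Formula.subst, ih, Subst.lift_comp]

theorem Formula.subst_id {Δ : List S} (A : Formula L Δ) : A.subst (Subst.id Δ) = A := by
  induction A with
  | atom P args => simp only [Formula.subst, Term.subst_id]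
  | top => rfl
  | bot => rfl
  | and A B ihA ihB => simp only [Formula.subst, ihA, ihB]
  | or A B ihA ihB => simp only [Formula.subst, ihA, ihB]
  | imp A B ihA ihB => simp only [Formula.subst, ihA, ihB]
  | all s A ih => simp only [Formula.subst, Subst.lift_id, ih]
  | ex s A ih => simp only [Formula.subst, Subst.lift_id, ih]

theorem Formula.wk_subst_lift {Δ Δ' : List S} (s : S) (σ : Subst L Δ Δ') (A : Formula L Δ) :
    (A.subst (Subst.wk s)).subst (σ.lift s) = (A.subst σ).subst (Subst.wk s) := by
  rw [Formula.subst_subst, Formula.subst_subst, Subst.wk_comp_lift]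

theorem Formula.wk_subst_inst {Δ : List S} {s : S} (t : Term L Δ s) (A : Formula L Δ) :
    (A.subst (Subst.wk s)).subst (Subst.inst t) = A := by
  rw [Formula.subst_subst]
  exact A.subst_id

theorem Formula.inst_subst {Δ Δ' : List S} {s : S} (σ : Subst L Δ Δ') (t : Term L Δ s)
    (A : Formula L (s :: Δ)) :
    (A.subst (Subst.inst t)).subst σ = (A.subst (σ.lift s)).subst (Subst.inst (t.subst σ)) := by
  rw [Formula.subst_subst, Formula.subst_subst, Subst.lift_comp_inst, Subst.inst_comp]

theorem map_wk_subst_lift {Δ Δ' : List S} (s : S) (σ : Subst L Δ Δ') (Γ : List (Formula L Δ)) :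
    (Γ.map fun C => C.subst (Subst.wk s)).map (fun C => C.subst (σ.lift s)) =
      (Γ.map fun C => C.subst σ).map fun C => C.subst (Subst.wk s) := by
  simp only [List.map_map, Function.comp_def, Formula.wk_subst_lift]

theorem map_wk_subst_inst {Δ : List S} {s : S} (t : Term L Δ s) (Γ : List (Formula L Δ)) :
    (Γ.map fun C => C.subst (Subst.wk s)).map (fun C => C.subst (Subst.inst t)) = Γ := by
  simp only [List.map_map, Function.comp_def, Formula.wk_subst_inst, List.map_id']

end Substitutions

/-! ### Stability of congruence and derivability under conversion and substitution -/

section Substitutivity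

variable {S : Type} {L : Signature.{u} S} {R : RewriteSystem L}

theorem TermCongr.subst {Δ Δ' : List S} {s : S} {t t' : Term L Δ s} (h : TermCongr R t t')
    (σ : Subst L Δ Δ') : TermCongr R (t.subst σ) (t'.subst σ) := by
  induction h with
  | rule h τ =>
    rw [Term.subst_subst, Term.subst_subst]
    exact .rule h _
  | refl t => exact .refl _
  | symm _ ih => exact ih.symm
  | trans _ _ ih ih' => exact ih.trans ih'
  | app f _ ih => exact .app f ih

theorem Congr.subst {Δ Δ' : List S} {A B : Formula L Δ} (h : Congr R A B)
    (σ : Subst L Δ Δ') : Congr R (A.subst σ) (B.subst σ) := by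
  induction h generalizing Δ' with
  | rule h τ =>
    rw [Formula.subst_subst, Formula.subst_subst]
    exact .rule h _
  | refl A => exact .refl _
  | symm _ ih => exact (ih σ).symm
  | trans _ _ ih ih' => exact (ih σ).trans (ih' σ)
  | atom P h => exact .atom P fun r v => (h r v).subst σ
  | and _ _ ih ih' => exact .and (ih σ) (ih' σ)
  | or _ _ ih ih' => exact .or (ih σ) (ih' σ)
  | imp _ _ ih ih' => exact .imp (ih σ) (ih' σ)
  | all s _ ih => exact .all s (ih _)
  | ex s _ ih => exact .ex s (ih _)

/-- Conversion is admissible because each rule already absorbs a congruence: introductions in their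
side condition, eliminations of ∧, ⇒ and ∀ in the type of the major premise or of the instance. For
∨ and ∃ the conversion is pushed into the minor premises. -/
theorem Derives.conv {Δ : List S} {Γ : List (Formula L Δ)} {p : Proof L Δ} {A B : Formula L Δ}
    (h : Derives R Γ p A) (hAB : Congr R A B) : Derives R Γ p B := by
  induction h with
  | ax h hc => exact .ax h (hc.trans hAB)
  | topI h => exact .topI (hAB.symm.trans h)
  | botE h hc _ => exact .botE h hc
  | andI h h' hc _ _ => exact .andI h h' (hAB.symm.trans hc)
  | andE₁ h hc _ => exact .andE₁ h (hc.trans (.and hAB (.refl _)))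
  | andE₂ h hc _ => exact .andE₂ h (hc.trans (.and (.refl _) hAB))
  | orI₁ h hc _ => exact .orI₁ h (hAB.symm.trans hc)
  | orI₂ h hc _ => exact .orI₂ h (hAB.symm.trans hc)
  | orE h _ _ hc _ ih ih' => exact .orE h (ih hAB) (ih' hAB) hc
  | impI h hc _ => exact .impI h (hAB.symm.trans hc)
  | impE h h' hc _ _ => exact .impE h h' (hc.trans (.imp (.refl _) hAB))
  | allI h hc _ => exact .allI h (hAB.symm.trans hc)
  | allE h hc hc' _ => exact .allE h hc (hAB.symm.trans hc')
  | exI h hc hc' _ => exact .exI h (hAB.symm.trans hc) hc'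
  | exE h _ hc _ ih => exact .exE h (ih (hAB.subst _)) hc

theorem Derives.tsubst {Δ Δ' : List S} {Γ : List (Formula L Δ)} {p : Proof L Δ}
    {A : Formula L Δ} (h : Derives R Γ p A) (σ : Subst L Δ Δ') :
    Derives R (Γ.map fun C => C.subst σ) (p.tsubst σ) (A.subst σ) := by
  induction h generalizing Δ' with
  | ax h hc => exact .ax (by rw [List.getElem?_map, h]; rfl) (hc.subst σ)
  | topI h => exact .topI (h.subst σ)
  | botE _ hc ih => exact .botE (ih σ) (hc.subst σ)
  | andI _ _ hc ih ih' => exact .andI (ih σ) (ih' σ) (hc.subst σ)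
  | andE₁ _ hc ih => exact .andE₁ (ih σ) (hc.subst σ)
  | andE₂ _ hc ih => exact .andE₂ (ih σ) (hc.subst σ)
  | orI₁ _ hc ih => exact .orI₁ (ih σ) (hc.subst σ)
  | orI₂ _ hc ih => exact .orI₂ (ih σ) (hc.subst σ)
  | orE _ _ _ hc ih ih₁ ih₂ => exact .orE (ih σ) (ih₁ σ) (ih₂ σ) (hc.subst σ)
  | impI _ hc ih => exact .impI (ih σ) (hc.subst σ)
  | impE _ _ hc ih ih' => exact .impE (ih σ) (ih' σ) (hc.subst σ)
  | allI _ hc ih =>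
    refine .allI ?_ (hc.subst σ)
    rw [← map_wk_subst_lift]
    exact ih _
  | allE _ hc hc' ih =>
    refine .allE (ih σ) (hc.subst σ) ?_
    rw [← Formula.inst_subst]
    exact hc'.subst σ
  | exI _ hc hc' ih =>
    refine .exI (ih σ) (hc.subst σ) ?_
    rw [← Formula.inst_subst]
    exact hc'.subst σ
  | exE _ _ hc ih ih' =>
    refine .exE (ih σ) ?_ (hc.subst σ)
    rw [← map_wk_subst_lift, ← Formula.wk_subst_lift]
    exact ih' _

theorem Derives.ren {Δ : List S} {Γ Γ' : List (Formula L Δ)} {p : Proof L Δ}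
    {A : Formula L Δ} (h : Derives R Γ p A) {ρ : ℕ → ℕ}
    (hρ : ∀ n B, Γ[n]? = some B → Γ'[ρ n]? = some B) : Derives R Γ' (p.ren ρ) A := by
  have lift : ∀ {Δ : List S} {Γ Γ' : List (Formula L Δ)} {ρ : ℕ → ℕ} (C : Formula L Δ),
      (∀ n B, Γ[n]? = some B → Γ'[ρ n]? = some B) →
      ∀ n B, (C :: Γ)[n]? = some B → (C :: Γ')[liftRen ρ n]? = some B := by
    intro Δ Γ Γ' ρ C hρ n B
    cases n with
    | zero => exact id
    | succ n => exact hρ n B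
  have wk : ∀ {Δ : List S} {Γ Γ' : List (Formula L Δ)} {ρ : ℕ → ℕ} (s : S),
      (∀ n B, Γ[n]? = some B → Γ'[ρ n]? = some B) →
      ∀ n B, (Γ.map fun C => C.subst (Subst.wk s))[n]? = some B →
        (Γ'.map fun C => C.subst (Subst.wk s))[ρ n]? = some B := by
    intro Δ Γ Γ' ρ s hρ n B hB
    rw [List.getElem?_map, Option.map_eq_some_iff] at hB ⊢
    obtain ⟨C, hC, rfl⟩ := hB
    exact ⟨C, hρ n C hC, rfl⟩
  induction h generalizing ρ with
  | ax h hc => exact .ax (hρ _ _ h) hc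
  | topI h => exact .topI h
  | botE _ hc ih => exact .botE (ih hρ) hc
  | andI _ _ hc ih ih' => exact .andI (ih hρ) (ih' hρ) hc
  | andE₁ _ hc ih => exact .andE₁ (ih hρ) hc
  | andE₂ _ hc ih => exact .andE₂ (ih hρ) hc
  | orI₁ _ hc ih => exact .orI₁ (ih hρ) hc
  | orI₂ _ hc ih => exact .orI₂ (ih hρ) hc
  | orE _ _ _ hc ih ih₁ ih₂ => exact .orE (ih hρ) (ih₁ (lift _ hρ)) (ih₂ (lift _ hρ)) hc
  | impI _ hc ih => exact .impI (ih (lift _ hρ)) hc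
  | impE _ _ hc ih ih' => exact .impE (ih hρ) (ih' hρ) hc
  | allI _ hc ih => exact .allI (ih (wk _ hρ)) hc
  | allE _ hc hc' ih => exact .allE (ih hρ) hc hc'
  | exI _ hc hc' ih => exact .exI (ih hρ) hc hc'
  | exE _ _ hc ih ih' => exact .exE (ih hρ) (ih' (lift _ (wk _ hρ))) hc

theorem Derives.hsubst {Δ : List S} {Γ Γ' : List (Formula L Δ)} {p : Proof L Δ}
    {A : Formula L Δ} (h : Derives R Γ p A) {τ : ℕ → Proof L Δ}
    (hτ : ∀ n B, Γ[n]? = some B → Derives R Γ' (τ n) B) : Derives R Γ' (p.hsubst τ) A := by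
  have lift : ∀ {Δ : List S} {Γ Γ' : List (Formula L Δ)} {τ : ℕ → Proof L Δ} (C : Formula L Δ),
      (∀ n B, Γ[n]? = some B → Derives R Γ' (τ n) B) →
      ∀ n B, (C :: Γ)[n]? = some B → Derives R (C :: Γ') (liftHyp τ n) B := by
    intro Δ Γ Γ' τ C hτ n B hB
    cases n with
    | zero => exact .ax hB (.refl _)
    | succ n => exact (hτ n B hB).ren fun _ _ h => h
  have wk : ∀ {Δ : List S} {Γ Γ' : List (Formula L Δ)} {τ : ℕ → Proof L Δ} (s : S),
      (∀ n B, Γ[n]? = some B → Derives R Γ' (τ n) B) →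
      ∀ n B, (Γ.map fun C => C.subst (Subst.wk s))[n]? = some B →
        Derives R (Γ'.map fun C => C.subst (Subst.wk s)) (wkHyp s τ n) B := by
    intro Δ Γ Γ' τ s hτ n B hB
    rw [List.getElem?_map, Option.map_eq_some_iff] at hB
    obtain ⟨C, hC, rfl⟩ := hB
    exact (hτ n C hC).tsubst _
  induction h with
  | ax h hc => exact (hτ _ _ h).conv hc
  | topI h => exact .topI h
  | botE _ hc ih => exact .botE (ih hτ) hc
  | andI _ _ hc ih ih' => exact .andI (ih hτ) (ih' hτ) hc
  | andE₁ _ hc ih => exact .andE₁ (ih hτ) hc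
  | andE₂ _ hc ih => exact .andE₂ (ih hτ) hc
  | orI₁ _ hc ih => exact .orI₁ (ih hτ) hc
  | orI₂ _ hc ih => exact .orI₂ (ih hτ) hc
  | orE _ _ _ hc ih ih₁ ih₂ => exact .orE (ih hτ) (ih₁ (lift _ hτ)) (ih₂ (lift _ hτ)) hc
  | impI _ hc ih => exact .impI (ih (lift _ hτ)) hc
  | impE _ _ hc ih ih' => exact .impE (ih hτ) (ih' hτ) hc
  | allI _ hc ih => exact .allI (ih (wk _ hτ)) hc
  | allE _ hc hc' ih => exact .allE (ih hτ) hc hc'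
  | exI _ hc hc' ih => exact .exI (ih hτ) hc hc'
  | exE _ _ hc ih ih' => exact .exE (ih hτ) (ih' (lift _ (wk _ hτ))) hc

theorem Derives.inst {Δ : List S} {Γ : List (Formula L Δ)} {p q : Proof L Δ}
    {A B : Formula L Δ} (hp : Derives R (A :: Γ) p B) (hq : Derives R Γ q A) :
    Derives R Γ (p.inst q) B := by
  refine hp.hsubst fun n C hC => ?_
  cases n with
  | zero =>
    obtain rfl : A = C := by simpa using hC
    exact hq
  | succ n => exact .ax hC (.refl _)

end Substitutivity

/-! ### Subject reduction from injectivity of the connectives -/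

section SubjectReduction

variable {S : Type} {L : Signature.{u} S} {R : RewriteSystem L}

/-- The congruence defined by `R` can be inverted below connectives and quantifiers. -/
structure InjectiveConnectives (R : RewriteSystem L) : Prop where
  and : ∀ {Δ : List S} {A A' B B' : Formula L Δ},
    Congr R (.and A B) (.and A' B') → Congr R A A' ∧ Congr R B B'
  or : ∀ {Δ : List S} {A A' B B' : Formula L Δ},
    Congr R (.or A B) (.or A' B') → Congr R A A' ∧ Congr R B B'
  imp : ∀ {Δ : List S} {A A' B B' : Formula L Δ},
    Congr R (.imp A B) (.imp A' B') → Congr R A A' ∧ Congr R B B'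
  all : ∀ {Δ : List S} {s : S} {A A' : Formula L (s :: Δ)},
    Congr R (.all s A) (.all s A') → Congr R A A'
  ex : ∀ {Δ : List S} {s : S} {A A' : Formula L (s :: Δ)},
    Congr R (.ex s A) (.ex s A') → Congr R A A'

/-- At a cut, the introduction and the elimination each declare the cut formula congruent to a
compound proposition. These two propositions are thus congruent to each other, and injectivity
transfers the congruence to their components, where `Derives.conv` repairs the types. -/
theorem Derives.step (hR : InjectiveConnectives R) {Δ : List S} {Γ : List (Formula L Δ)}
    {p p' : Proof L Δ} {A : Formula L Δ} (h : Derives R Γ p A) (hp : Step p p') :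
    Derives R Γ p' A := by
  induction hp with
  | fst_pair p q =>
    obtain - | - | - | - | ⟨h, hc⟩ := h
    obtain - | - | - | ⟨h, -, hc'⟩ := h
    exact h.conv (hR.and (hc'.symm.trans hc)).1
  | snd_pair p q =>
    obtain - | - | - | - | - | ⟨h, hc⟩ := h
    obtain - | - | - | ⟨-, h, hc'⟩ := h
    exact h.conv (hR.and (hc'.symm.trans hc)).2
  | case_inl p q r =>
    cases h with
    | orE h hq _ hc =>
      cases h with
      | orI₁ h hc' => exact hq.inst (h.conv (hR.or (hc'.symm.trans hc)).1)
  | case_inr p q r =>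
    cases h with
    | orE h _ hq hc =>
      cases h with
      | orI₂ h hc' => exact hq.inst (h.conv (hR.or (hc'.symm.trans hc)).2)
  | app_lam p q =>
    cases h with
    | impE h hq hc =>
      cases h with
      | impI h hc' =>
        have := hR.imp (hc'.symm.trans hc)
        exact (h.inst (hq.conv this.1.symm)).conv this.2
  | tapp_tlam p t =>
    cases h with
    | allE h hc hc₁ =>
      cases h with
      | allI h hc' =>
        have := h.tsubst (Subst.inst t)
        rw [map_wk_subst_inst] at this
        exact this.conv (((hR.all (hc'.symm.trans hc)).subst _).trans hc₁.symm)
  | unpack_pack t p q =>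
    cases h with
    | exE h hq hc =>
      cases h with
      | exI h hc' hc₁ =>
        have := hq.tsubst (Subst.inst t)
        rw [List.map_cons, map_wk_subst_inst, Formula.wk_subst_inst] at this
        exact this.inst (h.conv (hc₁.trans ((hR.ex (hc'.symm.trans hc)).subst _)))
  | botE _ ih => cases h with | botE h hc => exact .botE (ih h) hc
  | pair_left q _ ih => cases h with | andI h h' hc => exact .andI (ih h) h' hc
  | pair_right p _ ih => cases h with | andI h h' hc => exact .andI h (ih h') hc
  | fst _ ih => cases h with | andE₁ h hc => exact .andE₁ (ih h) hc
  | snd _ ih => cases h with | andE₂ h hc => exact .andE₂ (ih h) hc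
  | inl _ ih => cases h with | orI₁ h hc => exact .orI₁ (ih h) hc
  | inr _ ih => cases h with | orI₂ h hc => exact .orI₂ (ih h) hc
  | case_major q r _ ih => cases h with | orE h h₁ h₂ hc => exact .orE (ih h) h₁ h₂ hc
  | case_left p r _ ih => cases h with | orE h h₁ h₂ hc => exact .orE h (ih h₁) h₂ hc
  | case_right p q _ ih => cases h with | orE h h₁ h₂ hc => exact .orE h h₁ (ih h₂) hc
  | lam _ ih => cases h with | impI h hc => exact .impI (ih h) hc
  | app_left q _ ih => cases h with | impE h h' hc => exact .impE (ih h) h' hc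
  | app_right p _ ih => cases h with | impE h h' hc => exact .impE h (ih h') hc
  | tlam s _ ih => cases h with | allI h hc => exact .allI (ih h) hc
  | tapp t _ ih => cases h with | allE h hc hc' => exact .allE (ih h) hc hc'
  | pack t _ ih => cases h with | exI h hc hc' => exact .exI (ih h) hc hc'
  | unpack_left q _ ih => cases h with | exE h h' hc => exact .exE (ih h) h' hc
  | unpack_right p _ ih => cases h with | exE h h' hc => exact .exE h (ih h') hc

theorem cutElimination_of_stronglyNormalizing (hR : InjectiveConnectives R)
    (hSN : ∀ {Δ : List S} {Γ : List (Formula L Δ)} {p : Proof L Δ} {A : Formula L Δ},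
      Derives R Γ p A → StronglyNormalizing p) : CutElimination R := by
  intro Δ Γ p A h
  refine ⟨hSN h, ?_⟩
  have hp : StronglyNormalizing p := hSN h
  -- Induction on the reduction tree: at a node that is not normal, take any reduct and keep its
  -- type by subject reduction.
  induction hp with
  | intro p _ ih =>
    by_cases hn : Normal p
    · exact ⟨p, .refl, hn, h⟩
    · simp only [Normal, not_forall, not_not] at hn
      obtain ⟨q, hq⟩ := hn
      obtain ⟨p', hr, hn, hd⟩ := ih q hq (h.step hR hq)
      exact ⟨p', .head hq hr, hn, hd⟩

end SubjectReduction


/-! ### Congruence of shapes and of heads -/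

section HeadCongruence

variable {S : Type} {L : Signature.{u} S}

/-- Congruence of propositions of the same shape, with congruent terms in their atoms. -/
inductive TermwiseCongr (R : RewriteSystem L) : {Δ : List S} → Formula L Δ → Formula L Δ → Prop
  | atom {Δ : List S} {as : List S} (P : L.Pred as) {a b : Subst L as Δ}
      (h : ∀ (r : S) (v : Var as r), TermCongr R (a r v) (b r v)) :
      TermwiseCongr R (.atom P a) (.atom P b)
  | top {Δ : List S} : TermwiseCongr R (.top : Formula L Δ) .top
  | bot {Δ : List S} : TermwiseCongr R (.bot : Formula L Δ) .bot
  | and {Δ : List S} {A A' B B' : Formula L Δ} :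
      TermwiseCongr R A A' → TermwiseCongr R B B' → TermwiseCongr R (.and A B) (.and A' B')
  | or {Δ : List S} {A A' B B' : Formula L Δ} :
      TermwiseCongr R A A' → TermwiseCongr R B B' → TermwiseCongr R (.or A B) (.or A' B')
  | imp {Δ : List S} {A A' B B' : Formula L Δ} :
      TermwiseCongr R A A' → TermwiseCongr R B B' → TermwiseCongr R (.imp A B) (.imp A' B')
  | all {Δ : List S} (s : S) {A A' : Formula L (s :: Δ)} :
      TermwiseCongr R A A' → TermwiseCongr R (.all s A) (.all s A')
  | ex {Δ : List S} (s : S) {A A' : Formula L (s :: Δ)} :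
      TermwiseCongr R A A' → TermwiseCongr R (.ex s A) (.ex s A')

/-- Congruence of propositions with the same main connective or quantifier. -/
inductive HeadCongr (R : RewriteSystem L) : {Δ : List S} → Formula L Δ → Formula L Δ → Prop
  | and {Δ : List S} {A A' B B' : Formula L Δ} :
      Congr R A A' → Congr R B B' → HeadCongr R (.and A B) (.and A' B')
  | or {Δ : List S} {A A' B B' : Formula L Δ} :
      Congr R A A' → Congr R B B' → HeadCongr R (.or A B) (.or A' B')
  | imp {Δ : List S} {A A' B B' : Formula L Δ} :
      Congr R A A' → Congr R B B' → HeadCongr R (.imp A B) (.imp A' B')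
  | all {Δ : List S} (s : S) {A A' : Formula L (s :: Δ)} :
      Congr R A A' → HeadCongr R (.all s A) (.all s A')
  | ex {Δ : List S} (s : S) {A A' : Formula L (s :: Δ)} :
      Congr R A A' → HeadCongr R (.ex s A) (.ex s A')

/-- Propositions built by a connective of positive arity or a quantifier. -/
def Formula.IsCompound : {Δ : List S} → Formula L Δ → Prop
  | _, .atom _ _ => False
  | _, .top => False
  | _, .bot => False
  | _, .and _ _ => True
  | _, .or _ _ => True
  | _, .imp _ _ => True
  | _, .all _ _ => True
  | _, .ex _ _ => True

variable {R : RewriteSystem L}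

theorem TermCongr.subst_congr {Δ Δ' : List S} {σ τ : Subst L Δ Δ'}
    (h : ∀ (s : S) (v : Var Δ s), TermCongr R (σ s v) (τ s v)) {s : S} (t : Term L Δ s) :
    TermCongr R (t.subst σ) (t.subst τ) := by
  induction t with
  | var v => exact h _ v
  | app f args ih => exact .app f ih

theorem TermwiseCongr.congr {Δ : List S} {A B : Formula L Δ} (h : TermwiseCongr R A B) :
    Congr R A B := by
  induction h with
  | atom P h => exact .atom P h
  | top => exact .refl _
  | bot => exact .refl _
  | and _ _ ih ih' => exact .and ih ih'
  | or _ _ ih ih' => exact .or ih ih'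
  | imp _ _ ih ih' => exact .imp ih ih'
  | all s _ ih => exact .all s ih
  | ex s _ ih => exact .ex s ih

theorem TermwiseCongr.subst_congr {Δ Δ' : List S} {σ τ : Subst L Δ Δ'}
    (h : ∀ (s : S) (v : Var Δ s), TermCongr R (σ s v) (τ s v)) (A : Formula L Δ) :
    TermwiseCongr R (A.subst σ) (A.subst τ) := by
  have lift : ∀ {Δ Δ' : List S} {σ τ : Subst L Δ Δ'} (s : S),
      (∀ (s : S) (v : Var Δ s), TermCongr R (σ s v) (τ s v)) →
      ∀ (r : S) (v : Var (s :: Δ) r), TermCongr R (σ.lift s r v) (τ.lift s r v) := by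
    intro Δ Δ' σ τ s h r v
    cases v with
    | zero => exact .refl _
    | succ v => exact (h r v).subst _
  induction A generalizing Δ' with
  | atom P args => exact .atom P fun r v => TermCongr.subst_congr h _
  | top => exact .top
  | bot => exact .bot
  | and A B ihA ihB => exact .and (ihA h) (ihB h)
  | or A B ihA ihB => exact .or (ihA h) (ihB h)
  | imp A B ihA ihB => exact .imp (ihA h) (ihB h)
  | all s A ih => exact .all s (ih (lift s h))
  | ex s A ih => exact .ex s (ih (lift s h))

/-- This is the point where the fine relation, which only touches terms and so is preserved by
unfolding, is relaxed to the coarse one, which allows full congruence below the head. -/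
theorem TermwiseCongr.headCongr {Δ : List S} {A B : Formula L Δ} (h : TermwiseCongr R A B)
    (hA : A.IsCompound) : B.IsCompound ∧ HeadCongr R A B := by
  cases h with
  | atom P h => exact hA.elim
  | top => exact hA.elim
  | bot => exact hA.elim
  | and h h' => exact ⟨trivial, .and h.congr h'.congr⟩
  | or h h' => exact ⟨trivial, .or h.congr h'.congr⟩
  | imp h h' => exact ⟨trivial, .imp h.congr h'.congr⟩
  | all s h => exact ⟨trivial, .all s h.congr⟩
  | ex s h => exact ⟨trivial, .ex s h.congr⟩

theorem HeadCongr.refl {Δ : List S} {A : Formula L Δ} (hA : A.IsCompound) : HeadCongr R A A := by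
  cases A with
  | atom => exact hA.elim
  | top => exact hA.elim
  | bot => exact hA.elim
  | and A B => exact .and (.refl _) (.refl _)
  | or A B => exact .or (.refl _) (.refl _)
  | imp A B => exact .imp (.refl _) (.refl _)
  | all s A => exact .all s (.refl _)
  | ex s A => exact .ex s (.refl _)

theorem HeadCongr.trans {Δ : List S} {A B C : Formula L Δ} (h : HeadCongr R A B)
    (h' : HeadCongr R B C) : HeadCongr R A C := by
  cases h with
  | and h₁ h₂ => cases h' with | and h₁' h₂' => exact .and (h₁.trans h₁') (h₂.trans h₂')
  | or h₁ h₂ => cases h' with | or h₁' h₂' => exact .or (h₁.trans h₁') (h₂.trans h₂')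
  | imp h₁ h₂ => cases h' with | imp h₁' h₂' => exact .imp (h₁.trans h₁') (h₂.trans h₂')
  | all s h => cases h' with | all _ h' => exact .all s (h.trans h')
  | ex s h => cases h' with | ex _ h' => exact .ex s (h.trans h')

end HeadCongruence

/-! ### Injectivity of connectives for arithmetic, by unfolding atoms -/

namespace Arith

open Srt

section Unfolding

variable {F : ℕ → Type u} {c : Scheme}

/-- One step of unfolding of an atomic proposition other than `Null`. -/
def unfold : {Δ : List Srt} → Formula (lang F c) Δ → Option (Formula (lang F c) Δ)
  | _, .atom Pred.eq args =>
      some (Formula.subst (L := lang F c) (Δ := [nat, nat])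
        (.all cls (.imp (mem v1 v0) (mem v2 v0))) args)
  | _, .atom Pred.isNat args =>
      some (Formula.subst (L := lang F c) (Δ := [nat])
        (.all cls (.imp (mem zero v0)
          (.imp (.all nat (.imp (isNat v0) (.imp (mem v0 v1) (mem (succ v0) v1))))
            (mem v1 v0)))) args)
  | _, .atom Pred.mem args =>
      match args cls (.succ .zero) with
      | .var _ => none
      | .app (Func.comp A) ys =>
          some ((A.1.map (incl F (Comp F c))).subst (Subst.cons (args nat .zero) ys))
  | _, _ => none

/-- `HeadReduces A H`: unfolding `A` repeatedly leads to the compound proposition `H`. -/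
inductive HeadReduces {Δ : List Srt} : Formula (lang F c) Δ → Formula (lang F c) Δ → Prop
  | refl {A : Formula (lang F c) Δ} : A.IsCompound → HeadReduces A A
  | step {A B H : Formula (lang F c) Δ} :
      unfold A = some B → HeadReduces B H → HeadReduces A H

/-- Only atoms unfold, so a compound proposition is already its own head form. -/
theorem HeadReduces.eq_of_isCompound {Δ : List Srt} {A H : Formula (lang F c) Δ}
    (h : HeadReduces A H) (hA : A.IsCompound) : H = A := by
  cases h with
  | refl => rfl
  | step h _ =>
    cases A with
    | atom => exact hA.elim
    | top => exact hA.elim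
    | bot => exact hA.elim
    | and => cases h
    | or => cases h
    | imp => cases h
    | all => cases h
    | ex => cases h

/-- Determinism of unfolding: since `unfold` is a function, the first step towards a head form is
forced. -/
theorem HeadReduces.of_unfold {Δ : List Srt} {A B H : Formula (lang F c) Δ}
    (h : HeadReduces A H) (hA : unfold A = some B) : HeadReduces B H := by
  cases h with
  | refl h =>
    cases A with
    | atom => exact h.elim
    | top => exact h.elim
    | bot => exact h.elim
    | and => cases hA
    | or => cases hA
    | imp => cases hA
    | all => cases hA
    | ex => cases hA
  | step h h' =>
    rw [hA] at h
    cases h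
    exact h'

theorem HeadReduces.isCompound {Δ : List Srt} {A H : Formula (lang F c) Δ}
    (h : HeadReduces A H) : H.IsCompound := by
  induction h with
  | refl h => exact h
  | step _ _ ih => exact ih

theorem not_headReduces {Δ : List Srt} {A H : Formula (lang F c) Δ} (hA : ¬ A.IsCompound)
    (hu : unfold A = none) : ¬ HeadReduces A H := by
  intro h
  cases h with
  | refl h => exact hA h
  | step h _ =>
    rw [hu] at h
    cases h

variable {E : Set (Equation (lang F c))}

/-- Congruent class terms have the same head symbol and congruent arguments. -/
theorem TermCongr.cls_inversion {Δ : List Srt} {s : Srt} {t t' : Term (lang F c) Δ s}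
    (h : TermCongr (HA E) t t') :
    s = nat ∨ t = t' ∨ ∃ (as : List Srt) (f : (lang F c).Func as s) (a b : Subst (lang F c) as Δ),
      t = .app f a ∧ t' = .app f b ∧ ∀ r v, TermCongr (HA E) (a r v) (b r v) := by
  induction h with
  | rule h σ =>
    -- Every term rule, including the equational axioms, relates terms of sort `nat`.
    left
    cases h <;> rfl
  | refl t => exact .inr (.inl rfl)
  | symm _ ih =>
    rcases ih with h | h | ⟨as, f, a, b, h, h', hab⟩
    · exact .inl h
    · exact .inr (.inl h.symm)
    · exact .inr (.inr ⟨as, f, b, a, h', h, fun r v => (hab r v).symm⟩)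
  | trans _ _ ih ih' =>
    rcases ih with h | rfl | ⟨as, f, a, b, rfl, rfl, hab⟩
    · exact .inl h
    · exact ih'
    · rcases ih' with h | rfl | ⟨as', f', a', b', h, rfl, hab'⟩
      · exact .inl h
      · exact .inr (.inr ⟨as, f, a, b, rfl, rfl, hab⟩)
      · cases h
        exact .inr (.inr ⟨as, f, a, b', rfl, rfl, fun r v => (hab r v).trans (hab' r v)⟩)
  | app f h _ => exact .inr (.inr ⟨_, f, _, _, rfl, rfl, h⟩)

/-- Unfolding instantiates a fixed proposition chosen by the predicate symbol or, for `ε`, by the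
class symbol at the head of the right argument. Rigidity of class terms makes that choice the same
on both sides, so the two results differ only by congruent terms. -/
theorem TermwiseCongr.unfold_congr {Δ : List Srt} {A B A' : Formula (lang F c) Δ}
    (h : TermwiseCongr (HA E) A B) (hA : unfold A = some A') :
    ∃ B', unfold B = some B' ∧ TermwiseCongr (HA E) A' B' := by
  cases h with
  | @atom _ _ P a b h =>
    cases P with
    | eq =>
      cases hA
      exact ⟨_, rfl, TermwiseCongr.subst_congr h _⟩
    | isNat =>
      cases hA
      exact ⟨_, rfl, TermwiseCongr.subst_congr h _⟩
    | null => cases hA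
    | mem =>
      have hc := TermCongr.cls_inversion (h cls (.succ .zero))
      simp only [unfold] at hA ⊢
      have key : ∀ {ys : List Srt} (k : Comp F c ys) (a' b' : Subst (lang F c) ys Δ),
          (∀ r v, TermCongr (HA E) (a' r v) (b' r v)) →
          TermwiseCongr (HA E)
            ((k.1.map (incl F (Comp F c))).subst (Subst.cons (a nat .zero) a'))
            ((k.1.map (incl F (Comp F c))).subst (Subst.cons (b nat .zero) b')) := by
        intro ys k a' b' hab
        refine TermwiseCongr.subst_congr (fun r v => ?_) _
        cases v with
        | zero => exact h _ _
        | succ v => exact hab _ v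
      rcases hc with hc | hc | ⟨as, f, a', b', ha, hb, hab⟩
      · cases hc
      · rw [← hc]
        generalize a cls (.succ .zero) = X at hA
        cases X with
        | var v => cases hA
        | app f ys =>
          cases f with
          | comp k =>
            cases hA
            exact ⟨_, rfl, key k _ _ fun _ _ => .refl _⟩
      · rw [ha] at hA
        rw [hb]
        cases f with
        | comp k =>
          cases hA
          exact ⟨_, rfl, key k _ _ hab⟩
  | top => cases hA
  | bot => cases hA
  | and => cases hA
  | or => cases hA
  | imp => cases hA
  | all => cases hA
  | ex => cases hA

theorem HeadReduces.termwiseCongr {Δ : List Srt} {A B H : Formula (lang F c) Δ}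
    (hH : HeadReduces A H) (h : TermwiseCongr (HA E) A B) :
    ∃ H', HeadReduces B H' ∧ HeadCongr (HA E) H H' := by
  induction hH generalizing B with
  | refl hA =>
    have := h.headCongr hA
    exact ⟨B, .refl this.1, this.2⟩
  | step hu _ ih =>
    obtain ⟨B', hB, h'⟩ := TermwiseCongr.unfold_congr h hu
    obtain ⟨H', hH', hc⟩ := ih h'
    exact ⟨H', .step hB hH', hc⟩

/-- The rules for `ε`, `=` and `N` are exactly one unfolding step, so both sides share their head
forms. The `Null` rules relate propositions that have none. -/
theorem PropRule.headReduces_iff {Δ₀ Δ : List Srt} {l r : Formula (lang F c) Δ₀}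
    (h : PropRule l r) (σ : Subst (lang F c) Δ₀ Δ) {H : Formula (lang F c) Δ} :
    HeadReduces (l.subst σ) H ↔ HeadReduces (r.subst σ) H := by
  have of_unfold : unfold (l.subst σ) = some (r.subst σ) →
      (HeadReduces (l.subst σ) H ↔ HeadReduces (r.subst σ) H) :=
    fun hu => ⟨fun h => h.of_unfold hu, .step hu⟩
  cases h with
  | comp A =>
    apply of_unfold
    refine congrArg (fun τ => some (Formula.subst _ τ)) ?_
    exact Subst.ext_cons rfl fun _ _ => rfl
  | eq =>
    apply of_unfold
    refine congrArg (fun τ => some (Formula.subst _ τ)) ?_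
    refine Subst.ext_cons rfl fun r v => ?_
    obtain - | ⟨⟨⟩⟩ := v
    rfl
  | isNat =>
    apply of_unfold
    refine congrArg (fun τ => some (Formula.subst _ τ)) ?_
    refine Subst.ext_cons rfl fun r v => ?_
    obtain ⟨⟩ := v
  -- `Null` is never unfolded: its value may depend on the equations, but it could only be ⊤ or ⊥,
  -- which are not compound.
  | null_zero => exact iff_of_false (not_headReduces id rfl) (not_headReduces id rfl)
  | null_succ => exact iff_of_false (not_headReduces id rfl) (not_headReduces id rfl)

/-- Both directions are proved together so that symmetry of the congruence is immediate in the
induction. -/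
theorem Congr.headReduces {Δ : List Srt} {A B : Formula (lang F c) Δ} (h : Congr (HA E) A B) :
    (∀ H, HeadReduces A H → ∃ H', HeadReduces B H' ∧ HeadCongr (HA E) H H') ∧
      ∀ H, HeadReduces B H → ∃ H', HeadReduces A H' ∧ HeadCongr (HA E) H H' := by
  have compound : ∀ {Δ : List Srt} {A B : Formula (lang F c) Δ}, A.IsCompound → B.IsCompound →
      HeadCongr (HA E) A B →
      ∀ H, HeadReduces A H → ∃ H', HeadReduces B H' ∧ HeadCongr (HA E) H H' := by
    intro Δ A B hA hB h H hH
    rw [hH.eq_of_isCompound hA]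
    exact ⟨B, .refl hB, h⟩
  induction h with
  | rule h σ =>
    exact ⟨fun H hH => ⟨H, (PropRule.headReduces_iff h σ).1 hH, .refl hH.isCompound⟩,
      fun H hH => ⟨H, (PropRule.headReduces_iff h σ).2 hH, .refl hH.isCompound⟩⟩
  | refl A => exact ⟨fun H hH => ⟨H, hH, .refl hH.isCompound⟩,
      fun H hH => ⟨H, hH, .refl hH.isCompound⟩⟩
  | symm _ ih => exact ih.symm
  | trans _ _ ih ih' =>
    constructor
    · intro H hH
      obtain ⟨H₁, h₁, e₁⟩ := ih.1 H hH
      obtain ⟨H₂, h₂, e₂⟩ := ih'.1 H₁ h₁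
      exact ⟨H₂, h₂, e₁.trans e₂⟩
    · intro H hH
      obtain ⟨H₁, h₁, e₁⟩ := ih'.2 H hH
      obtain ⟨H₂, h₂, e₂⟩ := ih.2 H₁ h₁
      exact ⟨H₂, h₂, e₁.trans e₂⟩
  | atom P h =>
    exact ⟨fun H hH => hH.termwiseCongr (.atom P h),
      fun H hH => hH.termwiseCongr (.atom P fun r v => (h r v).symm)⟩
  | and h h' _ _ => exact ⟨compound trivial trivial (.and h h'),
      compound trivial trivial (.and h.symm h'.symm)⟩
  | or h h' _ _ => exact ⟨compound trivial trivial (.or h h'),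
      compound trivial trivial (.or h.symm h'.symm)⟩
  | imp h h' _ _ => exact ⟨compound trivial trivial (.imp h h'),
      compound trivial trivial (.imp h.symm h'.symm)⟩
  | all s h _ => exact ⟨compound trivial trivial (.all s h),
      compound trivial trivial (.all s h.symm)⟩
  | ex s h _ => exact ⟨compound trivial trivial (.ex s h),
      compound trivial trivial (.ex s h.symm)⟩

theorem Congr.headCongr {Δ : List Srt} {A B : Formula (lang F c) Δ} (h : Congr (HA E) A B)
    (hA : A.IsCompound) (hB : B.IsCompound) : HeadCongr (HA E) A B := by
  obtain ⟨H, hH, hc⟩ := (Congr.headReduces h).1 A (.refl hA)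
  rwa [hH.eq_of_isCompound hB] at hc

theorem injectiveConnectives : InjectiveConnectives (HA E) where
  and h := by cases Congr.headCongr h trivial trivial with | and h h' => exact ⟨h, h'⟩
  or h := by cases Congr.headCongr h trivial trivial with | or h h' => exact ⟨h, h'⟩
  imp h := by cases Congr.headCongr h trivial trivial with | imp h h' => exact ⟨h, h'⟩
  all h := by cases Congr.headCongr h trivial trivial with | all _ h => exact h
  ex h := by cases Congr.headCongr h trivial trivial with | ex _ h => exact h

end Unfolding

end Arith


/-! ### Erased proof-terms: substitution and reduction -/

/-- Proof-terms without terms: the introduction and elimination of `∀` are rendered by a pair and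
its first projection, those of `∃` by an injection and a case analysis. -/
inductive ErasedProof : Type
  | hyp (n : ℕ) : ErasedProof
  | triv : ErasedProof
  | botE (p : ErasedProof) : ErasedProof
  | pair (p q : ErasedProof) : ErasedProof
  | fst (p : ErasedProof) : ErasedProof
  | snd (p : ErasedProof) : ErasedProof
  | inl (p : ErasedProof) : ErasedProof
  | inr (p : ErasedProof) : ErasedProof
  | case (p q r : ErasedProof) : ErasedProof
  | lam (p : ErasedProof) : ErasedProof
  | app (p q : ErasedProof) : ErasedProof

namespace ErasedProof

def ren : (ℕ → ℕ) → ErasedProof → ErasedProof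
  | ρ, hyp n => hyp (ρ n)
  | _, triv => triv
  | ρ, botE p => botE (p.ren ρ)
  | ρ, pair p q => pair (p.ren ρ) (q.ren ρ)
  | ρ, fst p => fst (p.ren ρ)
  | ρ, snd p => snd (p.ren ρ)
  | ρ, inl p => inl (p.ren ρ)
  | ρ, inr p => inr (p.ren ρ)
  | ρ, case p q r => case (p.ren ρ) (q.ren (liftRen ρ)) (r.ren (liftRen ρ))
  | ρ, lam p => lam (p.ren (liftRen ρ))
  | ρ, app p q => app (p.ren ρ) (q.ren ρ)

def lift (τ : ℕ → ErasedProof) : ℕ → ErasedProof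
  | 0 => hyp 0
  | n + 1 => (τ n).ren Nat.succ

def subst : (ℕ → ErasedProof) → ErasedProof → ErasedProof
  | τ, hyp n => τ n
  | _, triv => triv
  | τ, botE p => botE (p.subst τ)
  | τ, pair p q => pair (p.subst τ) (q.subst τ)
  | τ, fst p => fst (p.subst τ)
  | τ, snd p => snd (p.subst τ)
  | τ, inl p => inl (p.subst τ)
  | τ, inr p => inr (p.subst τ)
  | τ, case p q r => case (p.subst τ) (q.subst (lift τ)) (r.subst (lift τ))
  | τ, lam p => lam (p.subst (lift τ))
  | τ, app p q => app (p.subst τ) (q.subst τ)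

/-- Extension of a substitution by a proof-term for the last hypothesis. -/
def cons (q : ErasedProof) (τ : ℕ → ErasedProof) : ℕ → ErasedProof
  | 0 => q
  | n + 1 => τ n

def inst (p q : ErasedProof) : ErasedProof := p.subst (cons q hyp)

theorem subst_ren (p : ErasedProof) (ρ : ℕ → ℕ) (τ : ℕ → ErasedProof) :
    (p.ren ρ).subst τ = p.subst fun n => τ (ρ n) := by
  have lift_liftRen : ∀ (ρ : ℕ → ℕ) (τ : ℕ → ErasedProof),
      (fun n => lift τ (liftRen ρ n)) = lift fun n => τ (ρ n) := by
    intro ρ τ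
    funext n
    cases n <;> rfl
  induction p generalizing ρ τ <;> simp only [ren, subst, *]

theorem ren_ren (p : ErasedProof) (ρ ρ' : ℕ → ℕ) : (p.ren ρ).ren ρ' = p.ren fun n => ρ' (ρ n) := by
  have lift_lift : ∀ ρ ρ' : ℕ → ℕ,
      (fun n => liftRen ρ' (liftRen ρ n)) = liftRen fun n => ρ' (ρ n) := by
    intro ρ ρ'
    funext n
    cases n <;> rfl
  induction p generalizing ρ ρ' <;> simp only [ren, *]

theorem ren_subst (p : ErasedProof) (τ : ℕ → ErasedProof) (ρ : ℕ → ℕ) :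
    (p.subst τ).ren ρ = p.subst fun n => (τ n).ren ρ := by
  have liftRen_lift : ∀ (τ : ℕ → ErasedProof) (ρ : ℕ → ℕ),
      (fun n => (lift τ n).ren (liftRen ρ)) = lift fun n => (τ n).ren ρ := by
    intro τ ρ
    funext n
    cases n with
    | zero => rfl
    | succ n => simp only [lift, ren_ren, liftRen]
  induction p generalizing τ ρ <;> simp only [ren, subst, *]

theorem subst_subst (p : ErasedProof) (τ τ' : ℕ → ErasedProof) :
    (p.subst τ).subst τ' = p.subst fun n => (τ n).subst τ' := by
  have lift_lift : ∀ τ τ' : ℕ → ErasedProof,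
      (fun n => (lift τ n).subst (lift τ')) = lift fun n => (τ n).subst τ' := by
    intro τ τ'
    funext n
    cases n with
    | zero => rfl
    | succ n => simp only [lift, subst_ren, ren_subst]
  induction p generalizing τ τ' <;> simp only [subst, *]

theorem subst_hyp (p : ErasedProof) : p.subst hyp = p := by
  have lift_hyp : lift hyp = hyp := by
    funext n
    cases n <;> rfl
  induction p <;> simp only [subst, *]

/-- The form in which binders of hypotheses are opened in the adequacy proof: substitute under the
binder, then instantiate, is one extended substitution. -/
theorem inst_subst_lift (p q : ErasedProof) (τ : ℕ → ErasedProof) :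
    (p.subst (lift τ)).inst q = p.subst (cons q τ) := by
  rw [inst, subst_subst]
  congr 1
  funext n
  cases n with
  | zero => rfl
  | succ n => simp only [lift, subst_ren, cons, subst_hyp]

theorem subst_inst (p q : ErasedProof) (τ : ℕ → ErasedProof) :
    (p.inst q).subst τ = (p.subst (lift τ)).inst (q.subst τ) := by
  rw [inst_subst_lift, inst, subst_subst]
  congr 1
  funext n
  cases n <;> rfl

/-- One step of reduction. -/
inductive Step : ErasedProof → ErasedProof → Prop
  | fst_pair (p q : ErasedProof) : Step (fst (pair p q)) p
  | snd_pair (p q : ErasedProof) : Step (snd (pair p q)) q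
  | case_inl (p q r : ErasedProof) : Step (case (inl p) q r) (q.inst p)
  | case_inr (p q r : ErasedProof) : Step (case (inr p) q r) (r.inst p)
  | app_lam (p q : ErasedProof) : Step (app (lam p) q) (p.inst q)
  | botE {p p' : ErasedProof} : Step p p' → Step (botE p) (botE p')
  | pair_left {p p' : ErasedProof} (q : ErasedProof) : Step p p' → Step (pair p q) (pair p' q)
  | pair_right (p : ErasedProof) {q q' : ErasedProof} : Step q q' → Step (pair p q) (pair p q')
  | fst {p p' : ErasedProof} : Step p p' → Step (fst p) (fst p')
  | snd {p p' : ErasedProof} : Step p p' → Step (snd p) (snd p')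
  | inl {p p' : ErasedProof} : Step p p' → Step (inl p) (inl p')
  | inr {p p' : ErasedProof} : Step p p' → Step (inr p) (inr p')
  | case_major {p p' : ErasedProof} (q r : ErasedProof) : Step p p' → Step (case p q r) (case p' q r)
  | case_left (p : ErasedProof) {q q' : ErasedProof} (r : ErasedProof) :
      Step q q' → Step (case p q r) (case p q' r)
  | case_right (p q : ErasedProof) {r r' : ErasedProof} : Step r r' → Step (case p q r) (case p q r')
  | lam {p p' : ErasedProof} : Step p p' → Step (lam p) (lam p')
  | app_left {p p' : ErasedProof} (q : ErasedProof) : Step p p' → Step (app p q) (app p' q)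
  | app_right (p : ErasedProof) {q q' : ErasedProof} : Step q q' → Step (app p q) (app p q')

theorem Step.subst {p p' : ErasedProof} (h : Step p p') (τ : ℕ → ErasedProof) :
    Step (p.subst τ) (p'.subst τ) := by
  induction h generalizing τ with
  | fst_pair p q => exact .fst_pair _ _
  | snd_pair p q => exact .snd_pair _ _
  | case_inl p q r =>
    rw [subst_inst]
    exact .case_inl _ _ _
  | case_inr p q r =>
    rw [subst_inst]
    exact .case_inr _ _ _
  | app_lam p q =>
    rw [subst_inst]
    exact .app_lam _ _
  | botE _ ih => exact .botE (ih τ)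
  | pair_left q _ ih => exact .pair_left _ (ih τ)
  | pair_right p _ ih => exact .pair_right _ (ih τ)
  | fst _ ih => exact .fst (ih τ)
  | snd _ ih => exact .snd (ih τ)
  | inl _ ih => exact .inl (ih τ)
  | inr _ ih => exact .inr (ih τ)
  | case_major q r _ ih => exact .case_major _ _ (ih τ)
  | case_left p r _ ih => exact .case_left _ _ (ih _)
  | case_right p q _ ih => exact .case_right _ _ (ih _)
  | lam _ ih => exact .lam (ih _)
  | app_left q _ ih => exact .app_left _ (ih τ)
  | app_right p _ ih => exact .app_right _ (ih τ)

/-- Strong normalization. -/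
def SN (p : ErasedProof) : Prop := Acc (fun q q' => Step q' q) p

/-- Substitution sends each reduction step to a reduction step, so an infinite reduction of `p`
would give one of its instance. -/
theorem SN.of_subst {p : ErasedProof} {τ : ℕ → ErasedProof} (h : SN (p.subst τ)) : SN p := by
  generalize hq : p.subst τ = q at h
  induction h generalizing p with
  | intro q _ ih =>
    subst hq
    exact .intro _ fun p' hp => ih _ (hp.subst τ) rfl

theorem SN.lam {p : ErasedProof} (h : SN p) : SN (lam p) := by
  induction h with
  | intro p _ ih =>
    refine .intro _ fun p' hp => ?_
    cases hp with
    | lam hp => exact ih _ hp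

theorem SN.inl {p : ErasedProof} (h : SN p) : SN (inl p) := by
  induction h with
  | intro p _ ih =>
    refine .intro _ fun p' hp => ?_
    cases hp with
    | inl hp => exact ih _ hp

theorem SN.inr {p : ErasedProof} (h : SN p) : SN (inr p) := by
  induction h with
  | intro p _ ih =>
    refine .intro _ fun p' hp => ?_
    cases hp with
    | inr hp => exact ih _ hp

theorem SN.pair {p q : ErasedProof} (hp : SN p) (hq : SN q) : SN (pair p q) := by
  induction hp generalizing q with
  | intro p hp ihp =>
    induction hq with
    | intro q hq ihq =>
      refine .intro _ fun p' h => ?_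
      cases h with
      | pair_left _ h => exact ihp _ h (.intro q hq)
      | pair_right _ h => exact ihq _ h

theorem SN.triv : SN triv := .intro _ fun _ h => nomatch h

/-! ### Reducibility candidates -/

/-- Proof-terms ending with an introduction rule. -/
def IsIntro : ErasedProof → Prop
  | triv => True
  | pair _ _ => True
  | inl _ => True
  | inr _ => True
  | lam _ => True
  | _ => False

theorem IsIntro.step {p p' : ErasedProof} (hp : p.IsIntro) (h : Step p p') : p'.IsIntro := by
  cases h <;> first | exact trivial | exact hp.elim

/-- Reducibility candidates. -/
structure IsCandidate (X : Set ErasedProof) : Prop where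
  sn : ∀ {p}, p ∈ X → SN p
  step : ∀ {p p'}, p ∈ X → Step p p' → p' ∈ X
  neutral : ∀ {p}, ¬ p.IsIntro → (∀ p', Step p p' → p' ∈ X) → p ∈ X

end ErasedProof

open ErasedProof

abbrev Candidate : Type := {X : Set ErasedProof // IsCandidate X}

namespace Candidate

/-- A hypothesis is neutral and has no reduct; in particular no candidate is empty. -/
theorem hyp_mem (C : Candidate) (n : ℕ) : hyp n ∈ C.1 :=
  C.2.neutral id fun _ h => nomatch h

/-- The candidate of the strongly normalizing proof-terms all of whose introductions reached by
reduction satisfy `V`. -/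
def ofValues (V : ErasedProof → Prop) : Candidate :=
  ⟨{p | SN p ∧ ∀ v, Relation.ReflTransGen ErasedProof.Step p v → v.IsIntro → V v}, {
    sn := fun h => h.1
    step := fun h hs => ⟨h.1.inv hs, fun v hv => h.2 v (.head hs hv)⟩
    neutral := by
      intro p hp h
      refine ⟨.intro _ fun p' hp' => (h p' hp').1, fun v hv hi => ?_⟩
      rcases hv.cases_head with rfl | ⟨p', hs, hv⟩
      · exact (hp hi).elim
      · exact (h p' hs).2 v hv hi }⟩

variable {V W : ErasedProof → Prop}

theorem ofValues_mono (h : ∀ v, V v → W v) : ofValues V ≤ ofValues W :=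
  fun _ hp => ⟨hp.1, fun v hv hi => h v (hp.2 v hv hi)⟩

theorem value_of_mem {v : ErasedProof} (h : v ∈ (ofValues V).1) (hv : v.IsIntro) : V v :=
  h.2 v .refl hv

/-- Reducts of an introduction are introductions, so stability of `V` under a single step is enough
to control all of them. -/
theorem mem_ofValues {v : ErasedProof} (hv : v.IsIntro) (hsn : SN v) (h : V v)
    (hV : ∀ v v', v.IsIntro → V v → ErasedProof.Step v v' → V v') : v ∈ (ofValues V).1 := by
  refine ⟨hsn, fun v' hs _ => ?_⟩
  suffices v'.IsIntro ∧ V v' from this.2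
  clear * - hs hv h hV
  induction hs with
  | refl => exact ⟨hv, h⟩
  | tail _ hs ih => exact ⟨ih.1.step hs, hV _ _ ih.1 ih.2 hs⟩

theorem botE_mem (C : Candidate) {p : ErasedProof} (hp : SN p) : botE p ∈ C.1 := by
  induction hp with
  | intro p _ ih =>
    refine C.2.neutral id fun p' h => ?_
    cases h with
    | botE h => exact ih _ h

theorem fst_mem (C : Candidate) {p : ErasedProof} (hp : p ∈ (ofValues V).1)
    (hV : ∀ p q, V (pair p q) → p ∈ C.1) : fst p ∈ C.1 := by
  have hsn := hp.1
  induction hsn with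
  | intro p _ ih =>
    refine C.2.neutral id fun p' h => ?_
    cases h with
    | fst_pair p q => exact hV _ _ (value_of_mem hp trivial)
    | fst h => exact ih _ h ((ofValues V).2.step hp h)

theorem snd_mem (C : Candidate) {p : ErasedProof} (hp : p ∈ (ofValues V).1)
    (hV : ∀ p q, V (pair p q) → q ∈ C.1) : snd p ∈ C.1 := by
  have hsn := hp.1
  induction hsn with
  | intro p _ ih =>
    refine C.2.neutral id fun p' h => ?_
    cases h with
    | snd_pair p q => exact hV _ _ (value_of_mem hp trivial)
    | snd h => exact ih _ h ((ofValues V).2.step hp h)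

/-- An elimination is neutral, so it suffices that all its one-step reducts lie in `C`. Inner steps
are handled by induction on the strong normalization of the parts, the root contraction by the
condition on values; `fst_mem`, `snd_mem` and `case_mem` follow the same pattern. -/
theorem app_mem (A C : Candidate) {p q : ErasedProof} (hp : p ∈ (ofValues V).1) (hq : q ∈ A.1)
    (hV : ∀ p, V (lam p) → ∀ q ∈ A.1, p.inst q ∈ C.1) : app p q ∈ C.1 := by
  have hsn := hp.1
  induction hsn generalizing q with
  | intro p hpsn ihp =>
    have hqsn := A.2.sn hq
    induction hqsn with
    | intro q _ ihq =>
      refine C.2.neutral id fun p' h => ?_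
      cases h with
      | app_lam p q => exact hV _ (value_of_mem hp trivial) _ hq
      | app_left _ h => exact ihp _ h ((ofValues V).2.step hp h) hq
      | app_right _ h => exact ihq _ h (A.2.step hq h)

theorem case_mem (C : Candidate) {p q r : ErasedProof} (hp : p ∈ (ofValues V).1) (hq : SN q)
    (hr : SN r) (hl : ∀ p, V (inl p) → q.inst p ∈ C.1) (hl' : ∀ p, V (inr p) → r.inst p ∈ C.1) :
    case p q r ∈ C.1 := by
  have hsn := hp.1
  induction hsn generalizing q r with
  | intro p hpsn ihp =>
    induction hq generalizing r with
    | intro q hqsn ihq =>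
      induction hr with
      | intro r hrsn ihr =>
        refine C.2.neutral id fun p' h => ?_
        cases h with
        | case_inl p _ _ => exact hl _ (value_of_mem hp trivial)
        | case_inr p _ _ => exact hl' _ (value_of_mem hp trivial)
        | case_major _ _ h =>
          exact ihp _ h ((ofValues V).2.step hp h) (.intro q hqsn) (.intro r hrsn) hl hl'
        | case_left _ _ h =>
          -- The assumption on the branch survives its reduction because steps commute with
          -- instantiation.
          exact ihq _ h (.intro r hrsn) (fun p hp => C.2.step (hl p hp) (h.subst _)) hl'
        | case_right _ _ h => exact ihr _ h fun p hp => C.2.step (hl' p hp) (h.subst _)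

/-- A variable belongs to every candidate, so one instance is always available, and strong
normalization passes from it to the open body. -/
theorem sn_of_inst_mem {A C : Candidate} {p : ErasedProof} (h : ∀ q ∈ A.1, p.inst q ∈ C.1) : SN p :=
  SN.of_subst (C.2.sn (h _ (A.hyp_mem 0)))

/-! ### Connectives, quantifiers and fixed points on candidates -/

/-- The candidate of all strongly normalizing proof-terms. -/
def sn : Candidate := ofValues fun _ => True

theorem mem_sn {p : ErasedProof} (h : SN p) : p ∈ sn.1 := ⟨h, fun _ _ _ => trivial⟩

/-- Introductions of the wrong shape are left unconstrained, here and in most of the next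
definitions: an elimination applied to one of them is not a redex. -/
def and (A B : Candidate) : Candidate := ofValues fun
  | .pair p q => p ∈ A.1 ∧ q ∈ B.1
  | _ => True

def or (A B : Candidate) : Candidate := ofValues fun
  | .inl p => p ∈ A.1
  | .inr p => p ∈ B.1
  | _ => True

def imp (A B : Candidate) : Candidate := ofValues fun
  | .lam p => ∀ q ∈ A.1, p.inst q ∈ B.1
  | _ => True

/-- The second component of the pair is a dummy created by erasure. The first must belong to all
instances at once, since erasure leaves no argument on which it could depend. -/
def all {D : Type} (A : D → Candidate) : Candidate := ofValues fun
  | .pair p _ => ∀ d, p ∈ (A d).1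
  | _ => True

/-- Right injections are excluded because the erased elimination of ∃ is a case analysis with a
dummy right branch, about which nothing useful could be proved. -/
def ex {D : Type} (A : D → Candidate) : Candidate := ofValues fun
  | .inl p => ∃ d, p ∈ (A d).1
  | .inr _ => False
  | _ => True

theorem pair_mem_and {A B : Candidate} {p q : ErasedProof} (hp : p ∈ A.1) (hq : q ∈ B.1) :
    ErasedProof.pair p q ∈ (and A B).1 := by
  refine mem_ofValues trivial ((A.2.sn hp).pair (B.2.sn hq)) ⟨hp, hq⟩ fun v v' hv h hs => ?_
  cases hs with
  | pair_left _ hs => exact ⟨A.2.step h.1 hs, h.2⟩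
  | pair_right _ hs => exact ⟨h.1, B.2.step h.2 hs⟩
  | lam | inl | inr => trivial
  | _ => exact hv.elim

theorem inl_mem_or {A : Candidate} (B : Candidate) {p : ErasedProof} (hp : p ∈ A.1) :
    ErasedProof.inl p ∈ (or A B).1 := by
  refine mem_ofValues trivial (A.2.sn hp).inl hp fun v v' hv h hs => ?_
  cases hs with
  | inl hs => exact A.2.step h hs
  | inr hs => exact B.2.step h hs
  | lam | pair_left | pair_right => trivial
  | _ => exact hv.elim

theorem inr_mem_or (A : Candidate) {B : Candidate} {p : ErasedProof} (hp : p ∈ B.1) :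
    ErasedProof.inr p ∈ (or A B).1 := by
  refine mem_ofValues trivial (B.2.sn hp).inr hp fun v v' hv h hs => ?_
  cases hs with
  | inl hs => exact A.2.step h hs
  | inr hs => exact B.2.step h hs
  | lam | pair_left | pair_right => trivial
  | _ => exact hv.elim

theorem lam_mem_imp {A B : Candidate} {p : ErasedProof} (hp : ∀ q ∈ A.1, p.inst q ∈ B.1) :
    ErasedProof.lam p ∈ (imp A B).1 := by
  refine mem_ofValues trivial (sn_of_inst_mem hp).lam hp fun v v' hv h hs => ?_
  cases hs with
  | lam hs => exact fun q hq => B.2.step (h q hq) (hs.subst _)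
  | inl | inr | pair_left | pair_right => trivial
  | _ => exact hv.elim

theorem pair_mem_all {D : Type} {A : D → Candidate} (d : D) {p q : ErasedProof}
    (hp : ∀ d, p ∈ (A d).1) (hq : SN q) : ErasedProof.pair p q ∈ (all A).1 := by
  refine mem_ofValues trivial (((A d).2.sn (hp d)).pair hq) hp fun v v' hv h hs => ?_
  cases hs with
  | pair_left _ hs => exact fun d => (A d).2.step (h d) hs
  | pair_right _ hs => exact h
  | lam | inl | inr => trivial
  | _ => exact hv.elim

theorem inl_mem_ex {D : Type} {A : D → Candidate} {d : D} {p : ErasedProof} (hp : p ∈ (A d).1) :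
    ErasedProof.inl p ∈ (ex A).1 := by
  refine mem_ofValues trivial ((A d).2.sn hp).inl ⟨d, hp⟩ fun v v' hv h hs => ?_
  cases hs with
  | inl hs =>
    obtain ⟨d, h⟩ := h
    exact ⟨d, (A d).2.step h hs⟩
  | inr => exact h
  | lam | pair_left | pair_right => trivial
  | _ => exact hv.elim

theorem imp_mono {A A' B B' : Candidate} (hA : A' ≤ A) (hB : B ≤ B') : imp A B ≤ imp A' B' :=
  ofValues_mono fun v => match v with
    | .lam _ => fun h q hq => hB (h q (hA hq))
    | .hyp _ | .triv | .botE _ | .pair _ _ | .fst _ | .snd _ | .inl _ | .inr _ | .case _ _ _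
    | .app _ _ => id

theorem all_mono {D : Type} {A B : D → Candidate} (h : ∀ d, A d ≤ B d) : all A ≤ all B :=
  ofValues_mono fun v => match v with
    | .pair _ _ => fun hv d => h d (hv d)
    | .hyp _ | .triv | .botE _ | .lam _ | .fst _ | .snd _ | .inl _ | .inr _ | .case _ _ _
    | .app _ _ => id

/-- The least fixed point of a monotone operator on candidates. -/
def lfp (Φ : Candidate → Candidate) : Candidate :=
  ⟨{p | SN p ∧ ∀ Z : Candidate, Φ Z ≤ Z → p ∈ Z.1}, {
    sn := fun h => h.1
    step := fun h hs => ⟨h.1.inv hs, fun Z hZ => Z.2.step (h.2 Z hZ) hs⟩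
    neutral := fun hp h => ⟨.intro _ fun p' hp' => (h p' hp').1,
      fun Z hZ => Z.2.neutral hp fun p' hp' => (h p' hp').2 Z hZ⟩ }⟩

/-- Knaster–Tarski: monotonicity puts `Φ (lfp Φ)` below every prefixed point, hence below `lfp Φ`;
one more application of `Φ` shows that it is itself a prefixed point. -/
theorem lfp_eq {Φ : Candidate → Candidate} (hΦ : Monotone Φ) : Φ (lfp Φ) = lfp Φ := by
  have le : Φ (lfp Φ) ≤ lfp Φ := fun p hp =>
    ⟨(Φ (lfp Φ)).2.sn hp, fun Z hZ =>
      hZ (hΦ (fun _ (hq : _ ∈ (lfp Φ).1) => hq.2 Z hZ) hp)⟩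
  exact le_antisymm le fun p hp => hp.2 _ (hΦ le)

end Candidate

/-! ### Erasure of terms from proof-terms -/

section Erasure

variable {S : Type} {L : Signature.{u} S}

def Proof.erase : {Δ : List S} → Proof L Δ → ErasedProof
  | _, .hyp n => .hyp n
  | _, .triv => .triv
  | _, .botE p => .botE p.erase
  | _, .pair p q => .pair p.erase q.erase
  | _, .fst p => .fst p.erase
  | _, .snd p => .snd p.erase
  | _, .inl p => .inl p.erase
  | _, .inr p => .inr p.erase
  | _, .case p q r => .case p.erase q.erase r.erase
  | _, .lam p => .lam p.erase
  | _, .app p q => .app p.erase q.erase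
  | _, .tlam _ p => .pair p.erase .triv
  | _, .tapp p _ => .fst p.erase
  | _, .pack _ p => .inl p.erase
  | _, .unpack p q => .case p.erase q.erase .triv

theorem Proof.erase_tsubst {Δ Δ' : List S} (p : Proof L Δ) (σ : Subst L Δ Δ') :
    (p.tsubst σ).erase = p.erase := by
  induction p generalizing Δ' <;> simp only [Proof.tsubst, Proof.erase, *]

theorem Proof.erase_ren {Δ : List S} (p : Proof L Δ) (ρ : ℕ → ℕ) :
    (p.ren ρ).erase = p.erase.ren ρ := by
  induction p generalizing ρ <;> simp only [Proof.ren, Proof.erase, ErasedProof.ren, *]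

theorem Proof.erase_hsubst {Δ : List S} (p : Proof L Δ) (τ : ℕ → Proof L Δ) :
    (p.hsubst τ).erase = p.erase.subst fun n => (τ n).erase := by
  have lift : ∀ {Δ : List S} (τ : ℕ → Proof L Δ),
      (fun n => (liftHyp τ n).erase) = ErasedProof.lift fun n => (τ n).erase := by
    intro Δ τ
    funext n
    cases n with
    | zero => rfl
    | succ n => exact Proof.erase_ren _ _
  have wk : ∀ {Δ : List S} (s : S) (τ : ℕ → Proof L Δ),
      (fun n => (wkHyp s τ n).erase) = fun n => (τ n).erase :=
    fun s τ => funext fun n => Proof.erase_tsubst _ _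
  induction p <;> simp only [Proof.hsubst, Proof.erase, ErasedProof.subst, *]

theorem Proof.erase_inst {Δ : List S} (p q : Proof L Δ) :
    (p.inst q).erase = p.erase.inst q.erase := by
  rw [Proof.inst, Proof.erase_hsubst, ErasedProof.inst]
  congr 1
  funext n
  cases n <;> rfl

/-- Each step gives exactly one step, never zero. This is why quantifier rules are coded by pairs
and injections instead of being deleted: a quantifier cut remains a redex. -/
theorem Step.erase {Δ : List S} {p p' : Proof L Δ} (h : Step p p') :
    ErasedProof.Step p.erase p'.erase := by
  induction h with
  | fst_pair p q => exact .fst_pair _ _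
  | snd_pair p q => exact .snd_pair _ _
  | case_inl p q r =>
    rw [Proof.erase_inst]
    exact .case_inl _ _ _
  | case_inr p q r =>
    rw [Proof.erase_inst]
    exact .case_inr _ _ _
  | app_lam p q =>
    rw [Proof.erase_inst]
    exact .app_lam _ _
  | tapp_tlam p t =>
    rw [Proof.erase_tsubst]
    exact .fst_pair _ _
  | unpack_pack t p q =>
    rw [Proof.erase_inst, Proof.erase_tsubst]
    exact .case_inl _ _ _
  | botE _ ih => exact .botE ih
  | pair_left q _ ih => exact .pair_left _ ih
  | pair_right p _ ih => exact .pair_right _ ih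
  | fst _ ih => exact .fst ih
  | snd _ ih => exact .snd ih
  | inl _ ih => exact .inl ih
  | inr _ ih => exact .inr ih
  | case_major q r _ ih => exact .case_major _ _ ih
  | case_left p r _ ih => exact .case_left _ _ ih
  | case_right p q _ ih => exact .case_right _ _ ih
  | lam _ ih => exact .lam ih
  | app_left q _ ih => exact .app_left _ ih
  | app_right p _ ih => exact .app_right _ ih
  | tlam s _ ih => exact .pair_left _ ih
  | tapp t _ ih => exact .fst ih
  | pack t _ ih => exact .inl ih
  | unpack_left q _ ih => exact .case_major _ _ ih
  | unpack_right p _ ih => exact .case_left _ _ ih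

theorem StronglyNormalizing.of_erase {Δ : List S} {p : Proof L Δ} (h : SN p.erase) :
    StronglyNormalizing p := by
  generalize hq : p.erase = q at h
  induction h generalizing p with
  | intro q _ ih =>
    subst hq
    exact .intro _ fun p' hp => ih _ hp.erase rfl

end Erasure

/-! ### Candidate-valued models and adequacy -/

section Models

variable {S : Type} {L : Signature.{u} S}

/-- Valuations of the variables declared in `Δ`. -/
abbrev Valuation (D : S → Type) (Δ : List S) : Type := ∀ s : S, Var Δ s → D s

def Valuation.cons {D : S → Type} {s : S} {Δ : List S} (d : D s) (ρ : Valuation D Δ) :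
    Valuation D (s :: Δ)
  | _, .zero => d
  | r, .succ v => ρ r v

/-- Models in which propositions are interpreted by reducibility candidates. -/
structure Model (L : Signature.{u} S) where
  Dom : S → Type
  default : ∀ s, Dom s
  func : ∀ {as : List S} {s : S}, L.Func as s → Valuation Dom as → Dom s
  pred : ∀ {as : List S}, L.Pred as → Valuation Dom as → Candidate

def Term.interp (M : Model L) {Δ : List S} (ρ : Valuation M.Dom Δ) :
    {s : S} → Term L Δ s → M.Dom s
  | s, .var v => ρ s v
  | _, .app f args => M.func f fun r v => (args r v).interp M ρ

def Formula.interp (M : Model L) : {Δ : List S} → Formula L Δ → Valuation M.Dom Δ → Candidate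
  | _, .atom P args, ρ => M.pred P fun r v => (args r v).interp M ρ
  | _, .top, _ => .sn
  | _, .bot, _ => .sn
  | _, .and A B, ρ => .and (A.interp M ρ) (B.interp M ρ)
  | _, .or A B, ρ => .or (A.interp M ρ) (B.interp M ρ)
  | _, .imp A B, ρ => .imp (A.interp M ρ) (B.interp M ρ)
  | _, .all _ A, ρ => .all fun d => A.interp M (ρ.cons d)
  | _, .ex _ A, ρ => .ex fun d => A.interp M (ρ.cons d)

/-- The rewrite rules of `R` preserve interpretations in `M`. -/
structure Model.Validates (M : Model L) (R : RewriteSystem L) : Prop where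
  term : ∀ {Δ : List S} {s : S} {l r : Term L Δ s}, R.termRule l r →
    ∀ ρ : Valuation M.Dom Δ, l.interp M ρ = r.interp M ρ
  prop : ∀ {Δ : List S} {l r : Formula L Δ}, R.propRule l r →
    ∀ ρ : Valuation M.Dom Δ, l.interp M ρ = r.interp M ρ

variable {M : Model L}

theorem Term.interp_subst {Δ Δ' : List S} (σ : Subst L Δ Δ') (ρ : Valuation M.Dom Δ') {s : S}
    (t : Term L Δ s) : (t.subst σ).interp M ρ = t.interp M fun r v => (σ r v).interp M ρ := by
  induction t with
  | var v => rfl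
  | app f args ih => simp only [Term.subst, Term.interp, ih]

theorem Valuation.ext_cons {D : S → Type} {s : S} {Δ : List S} {ρ ρ' : Valuation D (s :: Δ)}
    (h₀ : ρ s .zero = ρ' s .zero) (h₁ : ∀ r (v : Var Δ r), ρ r (.succ v) = ρ' r (.succ v)) :
    ρ = ρ' := by
  funext r v
  cases v with
  | zero => exact h₀
  | succ v => exact h₁ r v

theorem Subst.interp_lift {Δ Δ' : List S} (σ : Subst L Δ Δ') (ρ : Valuation M.Dom Δ') {s : S}
    (d : M.Dom s) : (fun r v => (σ.lift s r v).interp M (ρ.cons d)) =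
      Valuation.cons d fun r v => (σ r v).interp M ρ :=
  Valuation.ext_cons rfl fun _ _ => Term.interp_subst _ _ _

theorem Formula.interp_subst {Δ Δ' : List S} (A : Formula L Δ) (σ : Subst L Δ Δ')
    (ρ : Valuation M.Dom Δ') :
    (A.subst σ).interp M ρ = A.interp M fun r v => (σ r v).interp M ρ := by
  induction A generalizing Δ' with
  | atom P args => simp only [Formula.subst, Formula.interp, Term.interp_subst]
  | top => rfl
  | bot => rfl
  | and A B ihA ihB => simp only [Formula.subst, Formula.interp, ihA, ihB]
  | or A B ihA ihB => simp only [Formula.subst, Formula.interp, ihA, ihB]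
  | imp A B ihA ihB => simp only [Formula.subst, Formula.interp, ihA, ihB]
  | all s A ih => simp only [Formula.subst, Formula.interp, ih, Subst.interp_lift]
  | ex s A ih => simp only [Formula.subst, Formula.interp, ih, Subst.interp_lift]

theorem Formula.interp_wk {Δ : List S} {s : S} (A : Formula L Δ) (ρ : Valuation M.Dom Δ)
    (d : M.Dom s) : (A.subst (Subst.wk s)).interp M (ρ.cons d) = A.interp M ρ :=
  A.interp_subst _ _

theorem Formula.interp_inst {Δ : List S} {s : S} (A : Formula L (s :: Δ)) (t : Term L Δ s)
    (ρ : Valuation M.Dom Δ) :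
    (A.subst (Subst.inst t)).interp M ρ = A.interp M (ρ.cons (t.interp M ρ)) := by
  rw [Formula.interp_subst]
  congr 1
  exact Valuation.ext_cons rfl fun _ _ => rfl

variable {R : RewriteSystem L}

theorem Model.Validates.termCongr (hM : M.Validates R) {Δ : List S} {s : S} {t t' : Term L Δ s}
    (h : TermCongr R t t') (ρ : Valuation M.Dom Δ) : t.interp M ρ = t'.interp M ρ := by
  induction h with
  | rule h σ =>
    rw [Term.interp_subst, Term.interp_subst]
    exact hM.term h _
  | refl t => rfl
  | symm _ ih => exact ih.symm
  | trans _ _ ih ih' => exact ih.trans ih'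
  | app f _ ih => simp only [Term.interp, ih]

theorem Model.Validates.congr (hM : M.Validates R) {Δ : List S} {A B : Formula L Δ}
    (h : Congr R A B) (ρ : Valuation M.Dom Δ) : A.interp M ρ = B.interp M ρ := by
  induction h with
  | rule h σ =>
    rw [Formula.interp_subst, Formula.interp_subst]
    exact hM.prop h _
  | refl A => rfl
  | symm _ ih => exact (ih ρ).symm
  | trans _ _ ih ih' => exact (ih ρ).trans (ih' ρ)
  | atom P h => simp only [Formula.interp, hM.termCongr (h _ _)]
  | and _ _ ih ih' => simp only [Formula.interp, ih, ih']
  | or _ _ ih ih' => simp only [Formula.interp, ih, ih']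
  | imp _ _ ih ih' => simp only [Formula.interp, ih, ih']
  | all s _ ih => simp only [Formula.interp, ih]
  | ex s _ ih => simp only [Formula.interp, ih]

/-- `τ` assigns to each hypothesis of `Γ` an element of its interpretation. -/
def Realizes (M : Model L) {Δ : List S} (Γ : List (Formula L Δ)) (ρ : Valuation M.Dom Δ)
    (τ : ℕ → ErasedProof) : Prop :=
  ∀ n B, Γ[n]? = some B → τ n ∈ (B.interp M ρ).1

theorem Realizes.cons {Δ : List S} {Γ : List (Formula L Δ)} {ρ : Valuation M.Dom Δ}
    {τ : ℕ → ErasedProof} (h : Realizes M Γ ρ τ) {A : Formula L Δ} {p : ErasedProof}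
    (hp : p ∈ (A.interp M ρ).1) : Realizes M (A :: Γ) ρ (ErasedProof.cons p τ) := by
  intro n B hB
  cases n with
  | zero =>
    obtain rfl : A = B := by simpa using hB
    exact hp
  | succ n => exact h n B hB

theorem Realizes.wk {Δ : List S} {Γ : List (Formula L Δ)} {ρ : Valuation M.Dom Δ}
    {τ : ℕ → ErasedProof} (h : Realizes M Γ ρ τ) {s : S} (d : M.Dom s) :
    Realizes M (Γ.map fun C => C.subst (Subst.wk s)) (ρ.cons d) τ := by
  intro n B hB
  rw [List.getElem?_map, Option.map_eq_some_iff] at hB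
  obtain ⟨C, hC, rfl⟩ := hB
  rw [Formula.interp_wk]
  exact h n C hC

/-- Adequacy of the interpretation. Congruent propositions denote equal candidates, so side
conditions become rewriting, and each rule reduces to the closure property of the corresponding
operation on candidates. -/
theorem Derives.erase_mem (hM : M.Validates R) {Δ : List S} {Γ : List (Formula L Δ)}
    {p : Proof L Δ} {A : Formula L Δ} (h : Derives R Γ p A) {ρ : Valuation M.Dom Δ}
    {τ : ℕ → ErasedProof} (hτ : Realizes M Γ ρ τ) : p.erase.subst τ ∈ (A.interp M ρ).1 := by
  induction h generalizing τ with
  | ax h hc =>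
    rw [← hM.congr hc]
    exact hτ _ _ h
  | topI hc =>
    rw [hM.congr hc]
    exact Candidate.mem_sn .triv
  -- No cut contracts `botE`, so strong normalization of the premise is all that is needed; ⊥ can
  -- therefore denote the same candidate as ⊤.
  | botE _ hc ih => exact Candidate.botE_mem _ (IsCandidate.sn (Subtype.property _) (ih hτ))
  | andI _ _ hc ih ih' =>
    rw [hM.congr hc]
    exact Candidate.pair_mem_and (ih hτ) (ih' hτ)
  | andE₁ _ hc ih =>
    have := ih hτ
    rw [hM.congr hc] at this
    exact Candidate.fst_mem _ this fun _ _ h => h.1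
  | andE₂ _ hc ih =>
    have := ih hτ
    rw [hM.congr hc] at this
    exact Candidate.snd_mem _ this fun _ _ h => h.2
  | orI₁ _ hc ih =>
    rw [hM.congr hc]
    exact Candidate.inl_mem_or _ (ih hτ)
  | orI₂ _ hc ih =>
    rw [hM.congr hc]
    exact Candidate.inr_mem_or _ (ih hτ)
  | @orE _ _ _ q r A B C _ _ _ _ hc ih ih₁ ih₂ =>
    have := ih hτ
    rw [hM.congr hc] at this
    have hq : ∀ u ∈ (A.interp M ρ).1,
        (q.erase.subst (ErasedProof.lift τ)).inst u ∈ (C.interp M ρ).1 := by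
      intro u hu
      rw [ErasedProof.inst_subst_lift]
      exact ih₁ (hτ.cons hu)
    have hr : ∀ u ∈ (B.interp M ρ).1,
        (r.erase.subst (ErasedProof.lift τ)).inst u ∈ (C.interp M ρ).1 := by
      intro u hu
      rw [ErasedProof.inst_subst_lift]
      exact ih₂ (hτ.cons hu)
    exact Candidate.case_mem _ this (Candidate.sn_of_inst_mem hq) (Candidate.sn_of_inst_mem hr)
      hq hr
  | impI _ hc ih =>
    rw [hM.congr hc]
    refine Candidate.lam_mem_imp fun q hq => ?_
    rw [ErasedProof.inst_subst_lift]
    exact ih (hτ.cons hq)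
  | impE _ _ hc ih ih' =>
    have := ih hτ
    rw [hM.congr hc] at this
    exact Candidate.app_mem _ _ this (ih' hτ) fun _ h => h
  | allI _ hc ih =>
    rw [hM.congr hc]
    -- A default element of the domain is needed: over an empty one, membership in all instances
    -- would say nothing about normalization.
    exact Candidate.pair_mem_all (M.default _) (fun d => ih (hτ.wk d)) .triv
  | allE _ hc hc' ih =>
    have := ih hτ
    rw [hM.congr hc] at this
    rw [hM.congr hc', Formula.interp_inst]
    exact Candidate.fst_mem _ this fun _ _ h => h _
  | exI _ hc hc' ih =>
    have := ih hτ
    rw [hM.congr hc', Formula.interp_inst] at this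
    rw [hM.congr hc]
    exact Candidate.inl_mem_ex this
  | @exE _ s _ _ q A B _ _ _ hc ih ih' =>
    have := ih hτ
    rw [hM.congr hc] at this
    have hq : ∀ d : M.Dom s, ∀ u ∈ (A.interp M (ρ.cons d)).1,
        (q.erase.subst (ErasedProof.lift τ)).inst u ∈ (B.interp M ρ).1 := by
      intro d u hu
      rw [ErasedProof.inst_subst_lift, ← Formula.interp_wk B ρ d]
      exact ih' ((hτ.wk d).cons hu)
    -- The default element again supplies an instance from which the left branch is seen to
    -- normalize; the dummy right branch is never selected by a value.
    exact Candidate.case_mem _ this (Candidate.sn_of_inst_mem (hq (M.default s))) .triv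
      (fun u ⟨d, hu⟩ => hq d u hu) fun _ h => h.elim

theorem Derives.stronglyNormalizing (hM : M.Validates R) {Δ : List S} {Γ : List (Formula L Δ)}
    {p : Proof L Δ} {A : Formula L Δ} (h : Derives R Γ p A) : StronglyNormalizing p := by
  have := h.erase_mem hM (ρ := fun s _ => M.default s) (τ := .hyp)
    fun n B _ => Candidate.hyp_mem _ n
  rw [ErasedProof.subst_hyp] at this
  exact .of_erase ((A.interp M _).2.sn this)

end Models

/-! ### The candidate model of arithmetic -/

namespace Arith

open Srt

/-- Numbers are interpreted in a one-point set, classes by reducibility candidates. -/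
abbrev Dom : Srt → Type
  | nat => Unit
  | cls => Candidate

/-- The operator whose least fixed point interprets `N`. -/
def natOp (Z : Candidate) : Candidate :=
  .all fun X : Candidate => .imp X (.imp (.all fun _ : Unit => .imp Z (.imp X X)) X)

/-- `Z` sits to the left of two nested implications, so its occurrence is positive. -/
theorem natOp_monotone : Monotone natOp := fun _ _ h =>
  Candidate.all_mono fun _ => Candidate.imp_mono le_rfl
    (Candidate.imp_mono (Candidate.all_mono fun _ => Candidate.imp_mono h le_rfl) le_rfl)

/-- Since all numbers coincide, membership in a class is the class itself, and the unfolding of `=`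
collapses to `X ⇒ X` for all `X`. -/
def predInterp : {as : List Srt} → Pred as → Valuation Dom as → Candidate
  | _, .eq, _ => .all fun X : Candidate => .imp X X
  | _, .isNat, _ => .lfp natOp
  | _, .null, _ => .sn
  | _, .mem, ρ => ρ cls (.succ .zero)

def funcInterp {F : ℕ → Type u} {K : List Srt → Type u}
    (k : ∀ {ys : List Srt}, K ys → Valuation Dom ys → Candidate) :
    {as : List Srt} → {s : Srt} → Func F K as s → Valuation Dom as → Dom s
  | _, _, .comp f, ρ => k f ρ
  | _, nat, _, _ => ()

/-- The model determined by an interpretation of the class symbols. -/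
def model (F : ℕ → Type u) {K : List Srt → Type u}
    (k : ∀ {ys : List Srt}, K ys → Valuation Dom ys → Candidate) : Model (sig F K) where
  Dom := Dom
  default
    | nat => ()
    | cls => .sn
  func := funcInterp k
  pred := predInterp

/-- Comprehension formulas contain no class symbols, so they can be interpreted here first; the
class symbols of the full language are then defined from these values without circularity. -/
def baseModel (F : ℕ → Type u) : Model (baseSig F) := model F fun f => nomatch f

/-- The model of the full language: class symbols are interpreted by comprehension. -/
def fullModel (F : ℕ → Type u) (c : Scheme) : Model (lang F c) :=
  model F fun A ρ => A.1.interp (baseModel F) (Valuation.cons (D := Dom) (s := nat) () ρ)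

variable {F : ℕ → Type u} {c : Scheme}

theorem interp_map_incl_term {Δ : List Srt} (ρ : Valuation Dom Δ) {s : Srt}
    (t : Term (baseSig F) Δ s) :
    (t.map (incl F (Comp F c))).interp (fullModel F c) ρ = t.interp (baseModel F) ρ := by
  induction t with
  | var v => rfl
  | app f args ih =>
    cases f with
    | comp k => exact nomatch k
    | _ => rfl

theorem interp_map_incl {Δ : List Srt} (A : Formula (baseSig F) Δ) (ρ : Valuation Dom Δ) :
    (A.map (incl F (Comp F c))).interp (fullModel F c) ρ = A.interp (baseModel F) ρ := by
  induction A with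
  | atom P args =>
    exact congrArg (predInterp P) (funext fun r => funext fun v => interp_map_incl_term ρ _)
  | top => rfl
  | bot => rfl
  | and A B ihA ihB => exact congrArg₂ Candidate.and (ihA ρ) (ihB ρ)
  | or A B ihA ihB => exact congrArg₂ Candidate.or (ihA ρ) (ihB ρ)
  | imp A B ihA ihB => exact congrArg₂ Candidate.imp (ihA ρ) (ihB ρ)
  | all s A ih => exact congrArg Candidate.all (funext fun d => ih _)
  | ex s A ih => exact congrArg Candidate.ex (funext fun d => ih _)

/-- Term rules and equations hold because both sides are the only number. Comprehension holds by the
definition of the class symbols, the rule for `N` by the fixed-point equation, and the remaining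
rules by computation, with ⊤, ⊥ and `Null` all denoting `Candidate.sn`. -/
theorem fullModel_validates (E : Set (Equation (lang F c))) :
    (fullModel F c).Validates (HA E) where
  term h ρ := by cases h <;> rfl
  prop h ρ := by
    cases h with
    | comp A =>
      refine Eq.trans ?_ (interp_map_incl _ _).symm
      refine congrArg (A.1.interp (baseModel F)) ?_
      exact Valuation.ext_cons rfl fun _ _ => rfl
    | eq => rfl
    | isNat => exact (Candidate.lfp_eq natOp_monotone).symm
    | null_zero => rfl
    | null_succ => rfl

end Arith

end DeductionModulo

theorem mainTheorem2 (F : ℕ → Type u) (c : DeductionModulo.Arith.Scheme)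
    (E : Set (DeductionModulo.Arith.Equation (DeductionModulo.Arith.lang F c))) :
    DeductionModulo.CutElimination (DeductionModulo.Arith.HA E) :=
  DeductionModulo.cutElimination_of_stronglyNormalizing
    DeductionModulo.Arith.injectiveConnectives
    fun h => h.stronglyNormalizing (DeductionModulo.Arith.fullModel_validates E)
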